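/- **Lemma (Value function estimation).** For a finite set $G\subseteq\mathbb R^d$, $q\in[1,\infty]$ and $\delta>0$, the effective radius $\overline r_{G,\delta}(q)$ is the least (infimal) $t\ge 0$ such that for all $\mathbf y\in\mathbb R^d$ with $\|\mathbf y\|_q\le 1$ at most a $\delta$-fraction of the points $\mathbf x\in G$ satisfies $|\mathbf x^T\mathbf y|\ge t$. For a finite set $S$ of states, $V:S\to\mathbb R^d$, $s_0\in S$ and $R_{\max}>0$, an approximate lattice oracle $\overline L_{G,V,\delta}$ is a unitary on a vector register (with basis $|\mathbf x\rangle$, $\mathbf x\in G$) and a state register (with basis $|s\rangle$, $s\in S$) such that for all $\varphi:G\to\mathbb R$ $$\frac1{\sqrt{|G|}}\sum_{\mathbf x\in G}e^{i\varphi(\mathbf x)}|\mathbf x\rangle|s_0\rangle\;\longmapsto\;\frac1{\sqrt{|G|}}\sum_{\mathbf x\in G}e^{i\varphi(\mathbf x)+i\frac{\mathbf x^TV(s_0)}{2\overline r_{G,\delta}(q)R_{\max}}}|\mathbf x\rangle|s_0\rangle .$$ There are universal constants $C>0$ and $m\in\mathbb N$ such that the following holds. Let $d\ge1$, $p,q\in[1,\infty]$,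 $0<\varepsilon<R_{\max}\le B$, $0<\delta\le\frac12$, let $O$ be an orthogonal $d\times d$ matrix, $S$ a finite set and $s_0\in S$. Let $n\in\mathbb N$ satisfy $2^n\ge 24\,d^{\frac12+\frac1p}B/\varepsilon$, and let $$G_O=\Big\{\tfrac{O^T\mathbf x}{2^n}:\mathbf x\in\{-2^{n-1}+\tfrac12,-2^{n-1}+\tfrac32,\dots,2^{n-1}-\tfrac12\}^d\Big\},\qquad M=\left\lceil\frac{32\pi\,\overline r_{G_O,\delta}(q)R_{\max}d^{\frac1p}}{\varepsilon}\right\rceil,\qquad L=\ln\!\Big(2+\frac{dR_{\max}}{\varepsilon}\Big).$$ Then there is a quantum query algorithm, independent of $V$, that for every $V:S\to\mathbb R^d$ with $\|V(s_0)\|_q\le B$ and every approximate lattice oracle $\overline L_{G_O,V,\delta}$ outputs, when run with this oracle, a vector $\mathbf v\in\mathbb R^d$ such that $$\|\mathbf v-OV(s_0)\|_p\le\varepsilon\quad\text{with probability at least }\tfrac56,$$ and whose number of calls to $\overline L_{G_O,V,\delta}$ is at most each of $$C\,M\,L^m,\qquad C\,\frac{\overline r_{G_O,\delta}(q)R_{\max}d^{\frac1p}}{\varepsilon}\,L^m,\qquad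 C\,\frac{R_{\max}}{\varepsilon}\,d^{\frac1p+\max\{0,\frac12-\frac1q\}}\sqrt{\ln\tfrac2\delta}\;L^m .$$ In particular it makes $\widetilde{\mathcal O}\big(\frac{R_{\max}}{\varepsilon}d^{\frac1p+\max\{0,\frac12-\frac1q\}}\big)$ calls for fixed $\delta$. (For rewards bounded by $R_{\max}$ in $\ell_q$-norm along a path of fixed length one can take $B=R_{\max}$.) -/

import Mathlib

open scoped ENNReal Matrix Kronecker

namespace QMC

noncomputable section

/-- The `ℓ_p`-norm of a real vector, `p ∈ [1, ∞]`. -/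
def lpNorm {d : ℕ} (p : ℝ≥0∞) (v : Fin d → ℝ) : ℝ := ‖WithLp.toLp p v‖

/-- The exponent `1 / p` for `p ∈ [1, ∞]`, with `1 / ∞ = 0`. -/
def recip (p : ℝ≥0∞) : ℝ := (p⁻¹).toReal

/-- The effective radius of a finite set `G ⊆ ℝ^d`: the least `t ≥ 0` such that for every `y` in the
unit `ℓ_q`-ball at most a `δ`-fraction of the points `x` of `G` satisfies `|xᵀ y| ≥ t`. (The set of
such `t` need not contain its infimum, so the least `t` is read as an infimum.) -/
def effectiveRadius {d : ℕ} (G : Finset (Fin d → ℝ)) (δ : ℝ) (q : ℝ≥0∞) : ℝ :=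
  sInf {t : ℝ | 0 ≤ t ∧ ∀ y : Fin d → ℝ, lpNorm q y ≤ 1 →
    ((G.filter fun x => t ≤ |x ⬝ᵥ y|).card : ℝ) / (G.card : ℝ) ≤ δ}

/-- The hypercubic grid of side length `1` with `2^n` points per dimension, centred at the origin
and rotated by `Oᵀ`: the points `Oᵀ x / 2^n` where each coordinate of `x` runs through
`-2^(n-1) + 1/2, -2^(n-1) + 3/2, …, 2^(n-1) - 1/2`. -/
def rotatedGrid {d : ℕ} (O : Matrix (Fin d) (Fin d) ℝ) (n : ℕ) : Finset (Fin d → ℝ) :=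
  Finset.univ.image fun k : Fin d → Fin (2 ^ n) =>
    Oᵀ *ᵥ fun j => (-((2 : ℝ) ^ n / 2) + 1 / 2 + ((k j : ℕ) : ℝ)) / 2 ^ n

/-- The state `|G|^(-1/2) ∑_{x ∈ G} e^{i φ(x)} |x⟩|s₀⟩` of a vector register with basis `G` and a
state register with basis `S`. -/
def phaseState {d : ℕ} {S : Type*} [DecidableEq S] (G : Finset (Fin d → ℝ)) (s₀ : S)
    (φ : G → ℝ) : G × S → ℂ :=
  fun b => if b.2 = s₀ then
    ((1 / Real.sqrt (G.card : ℝ) : ℝ) : ℂ) * Complex.exp (Complex.I * (φ b.1 : ℂ)) else 0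

/-- The unitary `U` on the vector and state registers acts as the approximate lattice oracle for the
vector `V s₀`: on every equal-weight superposition over `G` it multiplies the amplitude of
`|x⟩|s₀⟩` by `exp (i xᵀ V(s₀) / (2 r Rmax))`, where `r` is the effective radius of `G`. Nothing is
required of `U` outside the span of the vectors `|x⟩|s₀⟩`. -/
def IsValueOracle {d : ℕ} {S : Type*} [Fintype S] [DecidableEq S] (G : Finset (Fin d → ℝ))
    (δ : ℝ) (q : ℝ≥0∞) (Rmax : ℝ) (V : S → Fin d → ℝ) (s₀ : S)
    (U : Matrix.unitaryGroup (G × S) ℂ) : Prop :=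
  ∀ φ : G → ℝ,
    (U : Matrix (G × S) (G × S) ℂ) *ᵥ phaseState G s₀ φ =
      phaseState G s₀ fun x =>
        φ x + ((x : Fin d → ℝ) ⬝ᵥ V s₀) / (2 * effectiveRadius G δ q * Rmax)

/-- A quantum query algorithm whose oracle acts on a register with basis `Q` and whose outputs lie
in `Out`. It starts in a basis state of the query register together with a finite workspace `W`,
alternates oracle-independent unitaries with `queries` calls to the oracle, measures in the
canonical basis, and post-processes the outcome classically. -/
structure QueryAlgorithm (Q : Type*) [Fintype Q] [DecidableEq Q] (Out : Type*) where
  W : Type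
  fintypeW : Fintype W
  decidableEqW : DecidableEq W
  queries : ℕ
  init : Q × W
  gate : ℕ → Matrix.unitaryGroup (Q × W) ℂ
  output : Q × W → Out

namespace QueryAlgorithm

variable {Q : Type*} [Fintype Q] [DecidableEq Q] {Out : Type*}

attribute [instance] QueryAlgorithm.fintypeW QueryAlgorithm.decidableEqW

/-- The state right after the `k`-th call to the oracle `U` and the gate that follows it:
`gate k ⬝ (U ⊗ 1) ⬝ gate (k-1) ⬝ ⋯ ⬝ (U ⊗ 1) ⬝ gate 0` applied to the initial basis state. -/
def state (A : QueryAlgorithm Q Out) (U : Matrix.unitaryGroup Q ℂ) : ℕ → (Q × A.W → ℂ)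
  | 0 => (A.gate 0 : Matrix (Q × A.W) (Q × A.W) ℂ) *ᵥ Pi.single A.init 1
  | k + 1 => (A.gate (k + 1) : Matrix (Q × A.W) (Q × A.W) ℂ) *ᵥ
      (((U : Matrix Q Q ℂ) ⊗ₖ (1 : Matrix A.W A.W ℂ)) *ᵥ state A U k)

/-- The probability that the output of the algorithm, run with oracle `U`, lies in `E`. -/
def prob (A : QueryAlgorithm Q Out) (U : Matrix.unitaryGroup Q ℂ) (E : Set Out) : ℝ :=
  ∑ b : Q × A.W, (A.output ⁻¹' E).indicator (fun b => ‖A.state U A.queries b‖ ^ 2) b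

end QueryAlgorithm

end

end QMC

/-! The proof is multidimensional phase estimation with a coordinatewise median. For `x = Oᵀ g` the
phase `xᵀ V(s₀)` equals `∑ g_j (O V(s₀))_j`, so `M'` oracle calls turn the uniform superposition
over the grid into a tensor product of one-dimensional plane waves with frequencies `X_j = κ (O
V(s₀))_j`, where `κ = M' / (4 π r Rmax)`. The inverse Fourier transform makes each coordinate an
independent sample from a squared Dirichlet kernel centred at `X_j`, off by more than 4 with
probability at most 1/6 (`sum_norm_fourierSum_sq_tail_le`). The lower bound on `2^n` keeps `|X_j|`
far enough from the edge of the frequency range. Over `K = O(log d)` runs the median fails in a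
fixed coordinate with probability at most `(3/4)^K`, and a union bound over the coordinates leaves
1/6. Accuracy `4 / κ` per coordinate costs a factor `d^(1/p)` in `ℓ_p`, which fixes `M'`.

The oracle acts exactly on the relevant span, so `δ` enters only through `r`. Hoeffding's inequality
on the grid gives `r ≤ d^max(0, 1/2 - 1/q) √(log (2/δ))` (`effectiveRadius_le`). Conversely `r ≥
1/60` (`le_effectiveRadius`): a unit linear form is small on fewer than half of the grid points
(`card_grid_small`). This absorbs the rounding in `M'` into the bounds without a ceiling. -/

namespace QMC

/-! ### Independent repetition within one coherent query algorithm -/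

section Repetition

variable {Q : Type*} [Fintype Q]

theorem kronecker_one_mulVec {W : Type*} [Fintype W] [DecidableEq W] (A : Matrix Q Q ℂ)
    (v : Q → ℂ) (u : W → ℂ) :
    (A ⊗ₖ (1 : Matrix W W ℂ)) *ᵥ (fun b : Q × W => v b.1 * u b.2) =
      fun b => (A *ᵥ v) b.1 * u b.2 := by
  funext b
  obtain ⟨x, w⟩ := b
  simp only [Matrix.mulVec, dotProduct, Fintype.sum_prod_type, Matrix.kroneckerMap_apply,
    Matrix.one_apply, Finset.sum_mul]
  refine Finset.sum_congr rfl fun y _ => ?_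
  simp [mul_assoc]

variable [DecidableEq Q]

/-- The unitary `A ⊗ 1`. -/
noncomputable def liftGate (W : Type*) [Fintype W] [DecidableEq W] (A : Matrix.unitaryGroup Q ℂ) :
    Matrix.unitaryGroup (Q × W) ℂ :=
  ⟨(A : Matrix Q Q ℂ) ⊗ₖ (1 : Matrix W W ℂ), Matrix.kronecker_mem_unitary A.2 (one_mem _)⟩

/-- The exchange of the query register with one slot of the workspace. -/
def swapSlot {I : Type*} {K : ℕ} (e : Q ≃ I) (r : Fin K) : Equiv.Perm (Q × (Fin K → I)) where
  toFun b := (e.symm (b.2 r), Function.update b.2 r (e b.1))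
  invFun b := (e.symm (b.2 r), Function.update b.2 r (e b.1))
  left_inv b := by simp
  right_inv b := by simp

/-- The unitary that permutes the basis states. -/
noncomputable def permGate {B : Type*} [Fintype B] [DecidableEq B] (σ : Equiv.Perm B) :
    Matrix.unitaryGroup B ℂ :=
  ⟨σ.permMatrix ℂ, by
    rw [Matrix.mem_unitaryGroup_iff, Matrix.star_eq_conjTranspose, Matrix.conjTranspose_permMatrix,
      ← Matrix.permMatrix_mul]
    simp⟩

/-- The content of the workspace when the first `r` slots hold copies of `ψ`. -/
def slots {I : Type*} [DecidableEq I] {K : ℕ} (e : Q ≃ I) (q₀ : Q) (ψ : Q → ℂ) (r : ℕ)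
    (w : Fin K → I) : ℂ :=
  ∏ t : Fin K, if (t : ℕ) < r then ψ (e.symm (w t)) else if w t = e q₀ then 1 else 0

/-- Slot `r` still holds `q₀`, so the exchange stores the run's result and at the same time resets
the query register without any measurement. -/
theorem swapSlot_slots {I : Type*} [Fintype I] [DecidableEq I] {K : ℕ} (e : Q ≃ I) (q₀ : Q)
    (ψ : Q → ℂ) (r : Fin K) :
    (permGate (swapSlot e r) : Matrix (Q × (Fin K → I)) (Q × (Fin K → I)) ℂ) *ᵥ
        (fun b : Q × (Fin K → I) => ψ b.1 * slots e q₀ ψ r b.2) =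
      fun b : Q × (Fin K → I) => (Pi.single q₀ 1 : Q → ℂ) b.1 * slots e q₀ ψ (r + 1) b.2 := by
  funext b
  obtain ⟨x, w⟩ := b
  change (((swapSlot e r).permMatrix ℂ) *ᵥ _) _ = _
  rw [Matrix.permMatrix_mulVec]
  simp only [Function.comp_apply, swapSlot, Equiv.coe_fn_mk, slots]
  rw [← Finset.mul_prod_erase Finset.univ _ (Finset.mem_univ r),
    ← Finset.mul_prod_erase Finset.univ (fun t : Fin K => if (t : ℕ) < (r : ℕ) + 1 then _ else _)
      (Finset.mem_univ r)]
  have h : ∀ t ∈ Finset.univ.erase r,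
      (if (t : ℕ) < (r : ℕ) then ψ (e.symm (Function.update w r (e x) t)) else
        if Function.update w r (e x) t = e q₀ then (1 : ℂ) else 0) =
      (if (t : ℕ) < (r : ℕ) + 1 then ψ (e.symm (w t)) else if w t = e q₀ then 1 else 0) := by
    intro t ht
    have hne : t ≠ r := Finset.ne_of_mem_erase ht
    have hne' : (t : ℕ) ≠ r := fun h => hne (Fin.ext h)
    rw [Function.update_of_ne hne]
    have : (t : ℕ) < (r : ℕ) ↔ (t : ℕ) < (r : ℕ) + 1 := by omega
    simp only [this]
  rw [Finset.prod_congr rfl h]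
  by_cases hx : x = q₀ <;> simp [hx]

theorem single_eq_slots {R I : Type*} [DecidableEq R] [Fintype I] [DecidableEq I] {K : ℕ}
    (e : R ≃ I) (q₀ : R) (ψ : R → ℂ) :
    (Pi.single (q₀, fun _ => e q₀) 1 : R × (Fin K → I) → ℂ) =
      fun b => (Pi.single q₀ 1 : R → ℂ) b.1 * slots e q₀ ψ 0 b.2 := by
  funext b
  obtain ⟨x, w⟩ := b
  simp only [slots, Nat.not_lt_zero, if_false, Finset.prod_ite_zero, Finset.mem_univ,
    forall_true_left, Finset.prod_const_one, Pi.single_apply, Prod.mk.injEq, funext_iff]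
  by_cases h1 : x = q₀ <;> simp [h1]

theorem roundGate_mulVec {I : Type*} [Fintype I] [DecidableEq I] {K : ℕ}
    (P F : Matrix.unitaryGroup Q ℂ) (e : Q ≃ I) (q₀ : Q) (r : Fin K) (v ψ : Q → ℂ)
    (hψ : (F : Matrix Q Q ℂ) *ᵥ v = ψ) :
    ((liftGate (Fin K → I) P * permGate (swapSlot e r) * liftGate (Fin K → I) F :
        Matrix.unitaryGroup (Q × (Fin K → I)) ℂ) : Matrix (Q × (Fin K → I)) (Q × (Fin K → I)) ℂ) *ᵥ
        (fun b : Q × (Fin K → I) => v b.1 * slots e q₀ ψ r b.2) =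
      fun b : Q × (Fin K → I) =>
        ((P : Matrix Q Q ℂ) *ᵥ Pi.single q₀ 1) b.1 * slots e q₀ ψ (r + 1) b.2 := by
  rw [Submonoid.coe_mul, Submonoid.coe_mul, ← Matrix.mulVec_mulVec, ← Matrix.mulVec_mulVec]
  have h2 := kronecker_one_mulVec (W := Fin K → I) (F : Matrix Q Q ℂ) v (slots e q₀ ψ r)
  refine (congrArg _ (congrArg _ h2)).trans ?_
  rw [hψ, swapSlot_slots]
  exact kronecker_one_mulVec _ _ _

/-- The algorithm that `K` times prepares `P |q₀⟩`, calls the oracle `M` times, applies `F` and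
stores the result in a fresh slot of the workspace. -/
noncomputable def repeatedAlgorithm {Out : Type*} (P F : Matrix.unitaryGroup Q ℂ) (q₀ : Q)
    (M K : ℕ) (dec : (Fin K → Q) → Out) : QueryAlgorithm Q Out where
  -- The workspace must live in `Type`, whereas `Q` may lie in a higher universe; hence the slots
  -- hold indices of `Q`.
  W := Fin K → Fin (Fintype.card Q)
  fintypeW := inferInstance
  decidableEqW := inferInstance
  queries := K * M
  init := (q₀, fun _ => Fintype.equivFin Q q₀)
  -- For `M > 0`, a positive multiple `k` of `M` ends round `k / M - 1`, counted from 0. Its gate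
  -- also prepares the next round; after the last round this preparation is harmless, because only
  -- the slots are read.
  gate k := if k = 0 then liftGate _ P else
    if h : k % M = 0 ∧ k / M - 1 < K then
      liftGate _ P * permGate (swapSlot (Fintype.equivFin Q) ⟨k / M - 1, h.2⟩) * liftGate _ F
    else 1
  output b := dec fun r => (Fintype.equivFin Q).symm (b.2 r)

variable {Out : Type*} (P F : Matrix.unitaryGroup Q ℂ) (q₀ : Q) (M K : ℕ)
  (dec : (Fin K → Q) → Out) (U : Matrix.unitaryGroup Q ℂ)

/-- The state of the query register after one run. -/
noncomputable def runState : Q → ℂ :=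
  (F : Matrix Q Q ℂ) *ᵥ ((U : Matrix Q Q ℂ) ^ M *ᵥ ((P : Matrix Q Q ℂ) *ᵥ Pi.single q₀ 1))

theorem repeatedAlgorithm_state_add (r : ℕ)
    (hr : (repeatedAlgorithm P F q₀ M K dec).state U (r * M) = fun b =>
      ((P : Matrix Q Q ℂ) *ᵥ Pi.single q₀ 1) b.1 *
        slots (Fintype.equivFin Q) q₀ (runState P F q₀ M U) r b.2)
    (i : ℕ) (hi : i < M) :
    (repeatedAlgorithm P F q₀ M K dec).state U (r * M + i) = fun b =>
      ((U : Matrix Q Q ℂ) ^ i *ᵥ ((P : Matrix Q Q ℂ) *ᵥ Pi.single q₀ 1)) b.1 *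
        slots (Fintype.equivFin Q) q₀ (runState P F q₀ M U) r b.2 := by
  induction i with
  | zero => simpa using hr
  | succ i ih =>
    have hg : (repeatedAlgorithm P F q₀ M K dec).gate (r * M + i + 1) = 1 := by
      have : (r * M + i + 1) % M ≠ 0 := by
        rw [add_assoc, Nat.mul_add_mod_self_right, Nat.mod_eq_of_lt hi]; omega
      simp only [repeatedAlgorithm]
      rw [if_neg (by omega), dif_neg (fun h => this h.1)]
      rfl
    rw [← add_assoc, QueryAlgorithm.state, hg, ih (by omega)]
    refine (Matrix.one_mulVec _).trans ?_
    refine (kronecker_one_mulVec _ _ _).trans ?_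
    rw [Matrix.mulVec_mulVec, ← pow_succ']

theorem repeatedAlgorithm_state (hM : 0 < M) (r : ℕ) (hr : r ≤ K) :
    (repeatedAlgorithm P F q₀ M K dec).state U (r * M) = fun b =>
      ((P : Matrix Q Q ℂ) *ᵥ Pi.single q₀ 1) b.1 *
        slots (Fintype.equivFin Q) q₀ (runState P F q₀ M U) r b.2 := by
  induction r with
  | zero =>
    rw [zero_mul, QueryAlgorithm.state]
    refine (congrArg _ (single_eq_slots (Fintype.equivFin Q) q₀ (runState P F q₀ M U))).trans ?_
    exact kronecker_one_mulVec _ _ _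
  | succ r ih =>
    obtain ⟨i, rfl⟩ : ∃ i, M = i + 1 := ⟨M - 1, by omega⟩
    have hs := repeatedAlgorithm_state_add P F q₀ (i + 1) K dec U r (ih (by omega)) i (by omega)
    have hg : (repeatedAlgorithm P F q₀ (i + 1) K dec).gate (r * (i + 1) + i + 1) =
        liftGate _ P * permGate (swapSlot (Fintype.equivFin Q) ⟨r, hr⟩) * liftGate _ F := by
      have h0 : r * (i + 1) + i + 1 = (r + 1) * (i + 1) := by ring
      have h2 : (r + 1) * (i + 1) / (i + 1) - 1 = r := by
        rw [Nat.mul_div_cancel _ (by omega)]; omega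
      have h1 : (r + 1) * (i + 1) % (i + 1) = 0 ∧ (r + 1) * (i + 1) / (i + 1) - 1 < K :=
        ⟨Nat.mul_mod_left _ _, by rw [h2]; omega⟩
      rw [h0]
      simp only [repeatedAlgorithm]
      rw [if_neg (by positivity), dif_pos h1]
      simp only [h2]
      rfl
    rw [show (r + 1) * (i + 1) = r * (i + 1) + i + 1 by ring, QueryAlgorithm.state, hg, hs]
    have h1 := kronecker_one_mulVec (W := Fin K → Fin (Fintype.card Q)) (U : Matrix Q Q ℂ)
      ((U : Matrix Q Q ℂ) ^ i *ᵥ ((P : Matrix Q Q ℂ) *ᵥ Pi.single q₀ 1))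
      (slots (Fintype.equivFin Q) q₀ (runState P F q₀ (i + 1) U) r)
    have h3 : (U : Matrix Q Q ℂ) *ᵥ
        ((U : Matrix Q Q ℂ) ^ i *ᵥ ((P : Matrix Q Q ℂ) *ᵥ Pi.single q₀ 1)) =
        (U : Matrix Q Q ℂ) ^ (i + 1) *ᵥ ((P : Matrix Q Q ℂ) *ᵥ Pi.single q₀ 1) := by
      rw [Matrix.mulVec_mulVec, ← pow_succ']
    rw [h3] at h1
    refine (congrArg _ h1).trans ?_
    refine (roundGate_mulVec P F (Fintype.equivFin Q) q₀ ⟨r, hr⟩ _ _ ?_)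
    rfl

theorem sum_norm_sq_mulVec {B : Type*} [Fintype B] [DecidableEq B] (A : Matrix.unitaryGroup B ℂ)
    (v : B → ℂ) : ∑ b, ‖((A : Matrix B B ℂ) *ᵥ v) b‖ ^ 2 = ∑ b, ‖v b‖ ^ 2 := by
  have h : ∀ u : B → ℂ, ((∑ b, ‖u b‖ ^ 2 : ℝ) : ℂ) = star u ⬝ᵥ u := by
    intro u
    simp only [dotProduct, Pi.star_apply, Complex.ofReal_sum, RCLike.star_def]
    refine Finset.sum_congr rfl fun b _ => ?_
    rw [Complex.conj_mul']; push_cast; rfl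
  have h2 := Matrix.UnitaryGroup.star_mul_self A
  apply Complex.ofReal_injective
  rw [h, h, Matrix.star_mulVec, Matrix.dotProduct_mulVec, Matrix.vecMul_vecMul,
    ← Matrix.star_eq_conjTranspose, h2, Matrix.vecMul_one]

/-- The final state is a product: the query register sums out to 1 and the slots are `K` independent
samples of one run. -/
theorem repeatedAlgorithm_prob (hM : 0 < M) (E : Set Out) :
    (repeatedAlgorithm P F q₀ M K dec).prob U E =
      ∑ w : Fin K → Q, (dec ⁻¹' E).indicator (fun w => ∏ t, ‖runState P F q₀ M U (w t)‖ ^ 2) w := by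
  have hq : (repeatedAlgorithm P F q₀ M K dec).queries = K * M := rfl
  rw [QueryAlgorithm.prob, hq, repeatedAlgorithm_state P F q₀ M K dec U hM K le_rfl]
  have hP : ∑ x, ‖((P : Matrix Q Q ℂ) *ᵥ Pi.single q₀ 1) x‖ ^ 2 = 1 := by
    rw [sum_norm_sq_mulVec, Finset.sum_eq_single q₀] <;> simp +contextual
  refine (Fintype.sum_prod_type _).trans ?_
  have hterm : ∀ (x : Q) (w : Fin K → Fin (Fintype.card Q)),
      ((repeatedAlgorithm P F q₀ M K dec).output ⁻¹' E).indicator (fun b =>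
        ‖((P : Matrix Q Q ℂ) *ᵥ Pi.single q₀ 1) b.1 *
          slots (Fintype.equivFin Q) q₀ (runState P F q₀ M U) K b.2‖ ^ 2) (x, w) =
      ‖((P : Matrix Q Q ℂ) *ᵥ Pi.single q₀ 1) x‖ ^ 2 *
        (dec ⁻¹' E).indicator (fun w => ∏ t, ‖runState P F q₀ M U (w t)‖ ^ 2)
          (fun t => (Fintype.equivFin Q).symm (w t)) := by
    intro x w
    classical
    have h1 : ((x, w) ∈ (repeatedAlgorithm P F q₀ M K dec).output ⁻¹' E) ↔
      (fun t => (Fintype.equivFin Q).symm (w t)) ∈ dec ⁻¹' E := Iff.rfl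
    by_cases h2 : (fun t => (Fintype.equivFin Q).symm (w t)) ∈ dec ⁻¹' E
    · refine (Set.indicator_of_mem (h1.2 h2) _).trans ?_
      rw [Set.indicator_of_mem h2]
      simp [slots, mul_pow, Finset.prod_pow, norm_prod]
    · refine (Set.indicator_of_notMem (fun h => h2 (h1.1 h)) _).trans ?_
      rw [Set.indicator_of_notMem h2, mul_zero]
  refine (Finset.sum_congr rfl fun x _ => Finset.sum_congr rfl fun w _ => hterm x w).trans ?_
  refine (Finset.sum_congr rfl fun x _ => (Finset.mul_sum _ _ _).symm).trans ?_
  rw [← Finset.sum_mul, hP, one_mul]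
  exact Fintype.sum_equiv (Equiv.arrowCongr (Equiv.refl _) (Fintype.equivFin Q).symm) _ _
    fun w => rfl

end Repetition

/-! ### Dirichlet kernel and Fourier transform on the grid -/

section Fourier

/-- The `z`-th of `N` equally spaced points of `[-1/2, 1/2]`, symmetric about the origin. -/
noncomputable def gridPoint (N : ℕ) (z : ℕ) : ℝ := (-((N : ℝ) / 2) + 1 / 2 + z) / N

/-- The normalised sum of the frequency-`u` character over the grid. -/
noncomputable def fourierSum (N : ℕ) (u : ℝ) : ℂ :=
  (1 / N : ℂ) * ∑ z : Fin N, Complex.exp (Complex.I * (2 * Real.pi * gridPoint N z * u : ℝ))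

theorem fourierSum_zero {N : ℕ} (hN : 0 < N) : fourierSum N 0 = 1 := by
  have : (N : ℂ) ≠ 0 := by exact_mod_cast hN.ne'
  simp [fourierSum, this]

/-- Geometric sum with ratio `exp (2πiu/N)`. The product form stays valid where the denominator `sin
(πu/N)` vanishes. -/
theorem norm_fourierSum_mul {N : ℕ} (hN : 0 < N) (u : ℝ) :
    N * ‖fourierSum N u‖ * |Real.sin (Real.pi * u / N)| = |Real.sin (Real.pi * u)| := by
  have hN' : (N : ℝ) ≠ 0 := by exact_mod_cast hN.ne'
  set w : ℂ := Complex.exp (Complex.I * (2 * Real.pi * u / N : ℝ)) with hw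
  have hterm : ∀ z : ℕ, Complex.exp (Complex.I * (2 * Real.pi * gridPoint N z * u : ℝ)) =
      Complex.exp (Complex.I * (2 * Real.pi * gridPoint N 0 * u : ℝ)) * w ^ z := by
    intro z
    rw [hw, ← Complex.exp_nat_mul, ← Complex.exp_add]
    congr 1
    have : 2 * Real.pi * gridPoint N z * u =
        2 * Real.pi * gridPoint N 0 * u + z * (2 * Real.pi * u / N) := by
      simp only [gridPoint]; push_cast; field_simp; ring
    rw [this]; push_cast; ring
  have hsum : fourierSum N u = (1 / N : ℂ) *
      (Complex.exp (Complex.I * (2 * Real.pi * gridPoint N 0 * u : ℝ)) *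
        ∑ z ∈ Finset.range N, w ^ z) := by
    rw [fourierSum, Fin.sum_univ_eq_sum_range
      (fun z => Complex.exp (Complex.I * (2 * Real.pi * gridPoint N z * u : ℝ)))]
    congr 1
    rw [Finset.mul_sum]
    exact Finset.sum_congr rfl fun z _ => hterm z
  have hn : N * ‖fourierSum N u‖ = ‖∑ z ∈ Finset.range N, w ^ z‖ := by
    rw [hsum, norm_mul, norm_mul, mul_comm Complex.I, Complex.norm_exp_ofReal_mul_I, one_mul,
      norm_div, norm_one, Complex.norm_natCast]
    field_simp
  have h1 : ‖w - 1‖ = 2 * |Real.sin (Real.pi * u / N)| := by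
    rw [hw, Complex.norm_exp_I_mul_ofReal_sub_one, Real.norm_eq_abs, abs_mul, abs_two]
    congr 3; ring
  have h2 : ‖w ^ N - 1‖ = 2 * |Real.sin (Real.pi * u)| := by
    have : w ^ N = Complex.exp (Complex.I * (2 * Real.pi * u : ℝ)) := by
      rw [hw, ← Complex.exp_nat_mul]
      congr 1
      have h : (N : ℂ) ≠ 0 := by exact_mod_cast hN.ne'
      push_cast; field_simp
    rw [this, Complex.norm_exp_I_mul_ofReal_sub_one, Real.norm_eq_abs, abs_mul, abs_two]
    congr 3; ring
  have h3 := congrArg norm (geom_sum_mul w N)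
  rw [norm_mul, h1, h2, ← hn] at h3
  linarith

theorem fourierSum_int {N : ℕ} (m : ℤ) (h0 : m ≠ 0) (hm : |m| < N) : fourierSum N m = 0 := by
  have hN : 0 < N := by have := abs_nonneg m; omega
  have hN' : (0 : ℝ) < N := by exact_mod_cast hN
  have h := norm_fourierSum_mul hN (m : ℝ)
  rw [mul_comm Real.pi (m : ℝ), Real.sin_int_mul_pi, abs_zero] at h
  have hs : Real.sin (m * Real.pi / N) ≠ 0 := by
    intro h
    obtain ⟨j, hj⟩ := Real.sin_eq_zero_iff.1 h
    have h1 : (j : ℝ) * N = m := by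
      field_simp at hj
      exact hj
    have h2 : j * N = m := by exact_mod_cast h1
    have h3 : j ≠ 0 := by rintro rfl; simp at h2; exact h0 h2.symm
    have h4 : 1 ≤ |j| := Int.one_le_abs h3
    rw [← h2, abs_mul, Nat.abs_cast] at hm
    nlinarith
  have : (N : ℝ) * ‖fourierSum N m‖ = 0 := by
    rcases mul_eq_zero.1 h with h | h
    · exact h
    · exact absurd (abs_eq_zero.1 h) hs
  rcases mul_eq_zero.1 this with h | h
  · exact absurd h hN'.ne'
  · exact norm_eq_zero.1 h

/-- The denominator `|sin (πu/N)|` has period `N` in `u`; Jordan's inequality bounds it below after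
reduction to `[-N/2, N/2]`. -/
theorem norm_fourierSum_sq_le {N : ℕ} (hN : 0 < N) (u : ℝ) (m : ℤ) (h : |u - N * m| ≤ N / 2)
    (h0 : u - N * m ≠ 0) : ‖fourierSum N u‖ ^ 2 ≤ 1 / (4 * |u - N * m| ^ 2) := by
  have hN' : (0 : ℝ) < N := by exact_mod_cast hN
  have hpi := Real.pi_pos
  have h1 := norm_fourierSum_mul hN u
  have h2 : |Real.sin (Real.pi * u / N)| = |Real.sin (Real.pi * (u - N * m) / N)| := by
    have : Real.pi * (u - N * m) / N = Real.pi * u / N - m * Real.pi := by field_simp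
    rw [this, Real.sin_sub_int_mul_pi, abs_mul, abs_zpow]
    simp
  have h3 : 2 / Real.pi * |Real.pi * (u - N * m) / N| ≤
      |Real.sin (Real.pi * (u - N * m) / N)| := by
    apply Real.mul_abs_le_abs_sin
    rw [abs_div, abs_mul, abs_of_pos hpi, abs_of_pos hN', div_le_iff₀ hN']
    nlinarith
  have h4 : 2 / Real.pi * |Real.pi * (u - N * m) / N| = 2 * |u - N * m| / N := by
    rw [abs_div, abs_mul, abs_of_pos hpi, abs_of_pos hN']; field_simp
  rw [h4, ← h2] at h3
  have h5 : 0 < |u - N * m| := abs_pos.2 h0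
  have h6 : ‖fourierSum N u‖ * (2 * |u - N * m|) ≤ 1 := by
    calc ‖fourierSum N u‖ * (2 * |u - N * m|)
        = N * ‖fourierSum N u‖ * (2 * |u - N * m| / N) := by field_simp
      _ ≤ N * ‖fourierSum N u‖ * |Real.sin (Real.pi * u / N)| := by gcongr
      _ = |Real.sin (Real.pi * u)| := h1
      _ ≤ 1 := Real.abs_sin_le_one _
  rw [le_div_iff₀ (by positivity)]
  have h7 : 0 ≤ ‖fourierSum N u‖ * (2 * |u - N * m|) := by positivity
  nlinarith

/-- The Fourier transform on the grid with frequencies `k - H`, as a matrix. -/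
noncomputable def fourierMatrix (N H : ℕ) : Matrix (Fin N) (Fin N) ℂ := fun z k =>
  ((1 / Real.sqrt N : ℝ) : ℂ) *
    Complex.exp (Complex.I * (2 * Real.pi * gridPoint N z * ((k : ℝ) - H) : ℝ))

theorem star_fourierMatrix_mulVec {N : ℕ} (hN : 0 < N) (H : ℕ) (X : ℝ) (k : Fin N) :
    ((star (fourierMatrix N H)) *ᵥ fun z : Fin N => ((1 / Real.sqrt N : ℝ) : ℂ) *
      Complex.exp (Complex.I * (2 * Real.pi * gridPoint N z * X : ℝ))) k =
      fourierSum N (X - (k - H)) := by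
  have hN' : (0 : ℝ) < N := by exact_mod_cast hN
  have hs : ((1 / Real.sqrt N : ℝ) : ℂ) * ((1 / Real.sqrt N : ℝ) : ℂ) = 1 / N := by
    rw [← Complex.ofReal_mul, div_mul_div_comm, Real.mul_self_sqrt hN'.le]
    push_cast; ring
  simp only [Matrix.mulVec, dotProduct, fourierSum, Finset.mul_sum, Matrix.star_apply,
    fourierMatrix]
  refine Finset.sum_congr rfl fun z _ => ?_
  rw [star_mul', RCLike.star_def, Complex.conj_ofReal, ← Complex.exp_conj,
    map_mul, Complex.conj_I, Complex.conj_ofReal, mul_mul_mul_comm, hs, ← Complex.exp_add]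
  congr 2
  push_cast; ring

theorem fourierMatrix_mem_unitaryGroup {N : ℕ} (hN : 0 < N) (H : ℕ) :
    fourierMatrix N H ∈ Matrix.unitaryGroup (Fin N) ℂ := by
  rw [Matrix.mem_unitaryGroup_iff']
  ext k l
  have h := star_fourierMatrix_mulVec hN H ((l : ℝ) - H) k
  have h1 : (star (fourierMatrix N H) * fourierMatrix N H) k l =
      fourierSum N ((l : ℝ) - H - (k - H)) := h
  rw [h1, Matrix.one_apply, show (l : ℝ) - H - ((k : ℝ) - H) = (((l : ℤ) - k : ℤ) : ℝ) by
    push_cast; ring]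
  split_ifs with hkl
  · subst hkl; simpa using fourierSum_zero hN
  · refine fourierSum_int _ ?_ ?_
    · intro h; exact hkl (Fin.ext (by omega))
    · rw [abs_lt]; omega

theorem sum_norm_fourierSum_sq {N : ℕ} (hN : 0 < N) (H : ℕ) (X : ℝ) :
    ∑ k : Fin N, ‖fourierSum N (X - (k - H))‖ ^ 2 = 1 := by
  have hN' : (0 : ℝ) < N := by exact_mod_cast hN
  have h := sum_norm_sq_mulVec ⟨_, Unitary.star_mem (fourierMatrix_mem_unitaryGroup hN H)⟩
    fun z : Fin N => ((1 / Real.sqrt N : ℝ) : ℂ) *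
      Complex.exp (Complex.I * (2 * Real.pi * gridPoint N z * X : ℝ))
  simp_rw [star_fourierMatrix_mulVec hN H X] at h
  rw [h]
  simp only [norm_mul, mul_comm Complex.I, Complex.norm_exp_ofReal_mul_I, mul_one,
    Complex.norm_real, Real.norm_eq_abs, sq_abs]
  rw [Finset.sum_const, Finset.card_univ, Fintype.card_fin, nsmul_eq_mul, div_pow,
    Real.sq_sqrt hN'.le]
  field_simp

/-- Distances modulo `N` from `X` to the frequencies are spaced by integers, so each integer part
occurs at most once on either side. The tail is then at most `2 ∑_{i ≥ 4} 1/(4 i²) ≤ 1/6`. -/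
theorem sum_norm_fourierSum_sq_tail_le {N : ℕ} (hN : 0 < N) (H : ℕ) (hNH : N = 2 * H) (X : ℝ)
    (hX : |X| ≤ N / 2 - 4) :
    ∑ k ∈ Finset.univ.filter (fun k : Fin N => 4 < |X - ((k : ℝ) - H)|),
      ‖fourierSum N (X - (k - H))‖ ^ 2 ≤ 1 / 6 := by
  have hN' : (0 : ℝ) < N := by exact_mod_cast hN
  have hNH' : (N : ℝ) = 2 * H := by exact_mod_cast hNH
  obtain ⟨hX1, hX2⟩ := abs_le.1 hX
  set u : Fin N → ℝ := fun k => X - ((k : ℝ) - H) with hu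
  set m : Fin N → ℤ := fun k => round (u k / N) with hm
  set v : Fin N → ℝ := fun k => u k - N * m k with hv
  have hvN : ∀ k, |v k| ≤ N / 2 := by
    intro k
    have h := abs_sub_round (u k / N)
    have h2 : v k = N * (u k / N - round (u k / N)) := by
      simp only [hv, hm]; field_simp
    rw [h2, abs_mul, abs_of_pos hN']
    nlinarith
  -- The margin 4 in `hX` gives `|u k| ≤ N - 4`, so an error cannot wrap around modulo `N` to within
  -- 4 of zero.
  have hv4 : ∀ k, 4 < |u k| → 4 ≤ |v k| := by
    intro k hk
    have hk1 : ((k : ℕ) : ℝ) + 1 ≤ N := by exact_mod_cast k.2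
    have hk0 : (0 : ℝ) ≤ ((k : ℕ) : ℝ) := by positivity
    have huN : |u k| ≤ N - 4 := by
      rw [abs_le]; constructor <;> simp only [hu] <;> linarith
    by_cases h0 : m k = 0
    · simp only [hv, h0]; simpa using hk.le
    · have h1 : (1 : ℝ) ≤ |(m k : ℝ)| := by exact_mod_cast Int.one_le_abs h0
      have h2 : |(N : ℝ) * m k| ≤ |u k| + |v k| := by
        have : (N : ℝ) * m k = u k - v k := by simp only [hv]; ring
        rw [this]; exact abs_sub _ _
      rw [abs_mul, abs_of_pos hN'] at h2
      nlinarith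
  set bad : Finset (Fin N) := {k : Fin N | 4 < |X - ((k : ℝ) - H)|} with hbad
  set φ : Fin N → Bool × ℕ := fun k => (decide (0 ≤ v k), ⌊|v k|⌋₊) with hφ
  have hinj : Set.InjOn φ bad := by
    intro k hk l hl h
    simp only [hφ, Prod.mk.injEq] at h
    obtain ⟨hs, hf⟩ := h
    have hs' : 0 ≤ v k ↔ 0 ≤ v l := by simpa using hs
    have h1 := Nat.floor_le (abs_nonneg (v k))
    have h2 := Nat.lt_floor_add_one (|v k|)
    have h3 := Nat.floor_le (abs_nonneg (v l))
    have h4 := Nat.lt_floor_add_one (|v l|)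
    rw [hf] at h1 h2
    generalize ⌊|v l|⌋₊ = a at h1 h2 h3 h4
    have h5 : |v k - v l| < 1 := by
      rw [abs_lt]
      by_cases h : 0 ≤ v k
      · rw [abs_of_nonneg h] at h1 h2
        rw [abs_of_nonneg (hs'.1 h)] at h3 h4
        constructor <;> linarith
      · have h' := fun h'' => h (hs'.2 h'')
        rw [abs_of_neg (not_le.1 h)] at h1 h2
        rw [abs_of_neg (not_le.1 h')] at h3 h4
        constructor <;> linarith
    -- An integer of absolute value below 1 is zero; hence `k` and `l` agree modulo `N`, so they are
    -- equal.
    have h6 : v k - v l = (((l : ℕ) : ℤ) - ((k : ℕ) : ℤ) - N * (m k - m l) : ℤ) := by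
      simp only [hv, hu]; push_cast; ring
    rw [h6] at h5
    have h7 : |((l : ℕ) : ℤ) - ((k : ℕ) : ℤ) - N * (m k - m l)| < 1 := by exact_mod_cast h5
    have h8 := Int.abs_lt_one_iff.1 h7
    have hkN := k.2
    have hlN := l.2
    have h9 : m k - m l = 0 := by
      by_contra hne
      have h10 : 1 ≤ |m k - m l| := Int.one_le_abs hne
      have h11 : |((l : ℕ) : ℤ) - ((k : ℕ) : ℤ)| = N * |m k - m l| := by
        rw [show ((l : ℕ) : ℤ) - ((k : ℕ) : ℤ) = N * (m k - m l) by linarith, abs_mul,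
          Nat.abs_cast]
      have h12 : |((l : ℕ) : ℤ) - ((k : ℕ) : ℤ)| < N := by rw [abs_lt]; omega
      nlinarith
    rw [h9] at h8
    exact Fin.ext (by omega)
  have hmem : ∀ k ∈ bad, φ k ∈ (Finset.univ : Finset Bool) ×ˢ Finset.Ioc 3 (max 3 N) := by
    intro k hk
    have h1 := hv4 k (by simpa [hbad] using hk)
    have h2 : 4 ≤ ⌊|v k|⌋₊ := Nat.le_floor (by exact_mod_cast h1)
    have h3 : ⌊|v k|⌋₊ ≤ N := by
      have := Nat.floor_le (abs_nonneg (v k))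
      have h4 := hvN k
      exact_mod_cast (show ((⌊|v k|⌋₊ : ℕ) : ℝ) ≤ N by linarith)
    simp only [hφ, Finset.mem_product, Finset.mem_univ, true_and, Finset.mem_Ioc]
    exact ⟨by omega, le_max_of_le_right h3⟩
  calc ∑ k ∈ bad, ‖fourierSum N (X - (k - H))‖ ^ 2
      ≤ ∑ k ∈ bad, 1 / (4 * ((φ k).2 : ℝ) ^ 2) := by
        refine Finset.sum_le_sum fun k hk => ?_
        have h1 := hv4 k (by simpa [hbad] using hk)
        have h2 : 4 ≤ ⌊|v k|⌋₊ := Nat.le_floor (by exact_mod_cast h1)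
        have h3 : (4 : ℝ) ≤ ((⌊|v k|⌋₊ : ℕ) : ℝ) := by exact_mod_cast h2
        have h4 := Nat.floor_le (abs_nonneg (v k))
        refine (norm_fourierSum_sq_le hN (u k) (m k) (hvN k) ?_).trans ?_
        · exact abs_pos.1 (lt_of_lt_of_le (by norm_num) h1)
        · apply one_div_le_one_div_of_le
          · simp only [hφ]; positivity
          · simp only [hφ]; gcongr
    _ = ∑ b ∈ bad.image φ, 1 / (4 * (b.2 : ℝ) ^ 2) :=
        (Finset.sum_image (f := fun b : Bool × ℕ => 1 / (4 * (b.2 : ℝ) ^ 2)) hinj).symm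
    _ ≤ ∑ b ∈ (Finset.univ : Finset Bool) ×ˢ Finset.Ioc 3 (max 3 N), 1 / (4 * (b.2 : ℝ) ^ 2) := by
        refine Finset.sum_le_sum_of_subset_of_nonneg ?_ fun _ _ _ => by positivity
        intro b hb
        obtain ⟨k, hk, rfl⟩ := Finset.mem_image.1 hb
        exact hmem k hk
    _ = 1 / 2 * ∑ i ∈ Finset.Ioc 3 (max 3 N), ((i : ℝ) ^ 2)⁻¹ := by
        rw [Finset.sum_product]
        simp only [Finset.sum_const, Finset.card_univ, Fintype.card_bool, nsmul_eq_mul,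
          Finset.mul_sum]
        refine Finset.sum_congr rfl fun i _ => ?_
        push_cast
        rw [one_div, mul_inv]; ring
    _ ≤ 1 / 2 * (((3 : ℕ) : ℝ)⁻¹ - ((max 3 N : ℕ) : ℝ)⁻¹) := by
        gcongr
        exact sum_Ioc_inv_sq_le_sub (by norm_num) (le_max_left _ _)
    _ ≤ 1 / 6 := by
        have : (0 : ℝ) ≤ ((max 3 N : ℕ) : ℝ)⁻¹ := by positivity
        push_cast at *
        linarith

/-- The `d`-fold tensor power of a matrix. -/
def tensorPow {I : Type*} (d : ℕ) (A : Matrix I I ℂ) : Matrix (Fin d → I) (Fin d → I) ℂ :=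
  fun z k => ∏ j, A (z j) (k j)

theorem tensorPow_mulVec {I : Type*} [Fintype I] [DecidableEq I] {d : ℕ} (A : Matrix I I ℂ)
    (f : Fin d → I → ℂ) (k : Fin d → I) :
    (tensorPow d A *ᵥ fun z => ∏ j, f j (z j)) k = ∏ j, (A *ᵥ f j) (k j) := by
  simp only [Matrix.mulVec, dotProduct, tensorPow, ← Finset.prod_mul_distrib]
  rw [Finset.prod_univ_sum, Fintype.piFinset_univ]

theorem star_tensorPow {I : Type*} {d : ℕ} (A : Matrix I I ℂ) :
    star (tensorPow d A) = tensorPow d (star A) := by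
  ext z k
  simp [tensorPow, Matrix.star_apply]

theorem tensorPow_mem_unitaryGroup {I : Type*} [Fintype I] [DecidableEq I] {d : ℕ}
    {A : Matrix I I ℂ} (hA : A ∈ Matrix.unitaryGroup I ℂ) :
    tensorPow d A ∈ Matrix.unitaryGroup (Fin d → I) ℂ := by
  rw [Matrix.mem_unitaryGroup_iff'] at hA ⊢
  ext k l
  have h := tensorPow_mulVec (star A) (fun j x => A x (l j)) k
  have h1 : (star (tensorPow d A) * tensorPow d A) k l = ∏ j, (star A * A) (k j) (l j) := by
    rw [star_tensorPow]; exact h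
  rw [h1, hA]
  simp only [Matrix.one_apply, Finset.prod_ite_zero, Finset.prod_const_one, funext_iff]
  simp

end Fourier

/-! ### Median amplification and product distributions -/

section Median

/-- A (lower) median of finitely many real numbers. -/
noncomputable def median {K : ℕ} (c : Fin K → ℝ) : ℝ :=
  sSup {l : ℝ | 2 * (Finset.univ.filter fun t => c t < l).card < K}

theorem median_mem_Icc {K : ℕ} (c : Fin K → ℝ) (l u : ℝ)
    (h : 2 * (Finset.univ.filter fun t => ¬ (l ≤ c t ∧ c t ≤ u)).card < K) :
    l ≤ median c ∧ median c ≤ u := by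
  have hl : l ∈ {l : ℝ | 2 * (Finset.univ.filter fun t => c t < l).card < K} := by
    refine lt_of_le_of_lt (Nat.mul_le_mul_left 2 (Finset.card_le_card ?_)) h
    intro t
    simp only [Finset.mem_filter, Finset.mem_univ, true_and]
    exact fun h1 h2 => absurd h2.1 (not_le.2 h1)
  have hu : ∀ a ∈ {l : ℝ | 2 * (Finset.univ.filter fun t => c t < l).card < K}, a ≤ u := by
    intro a ha
    by_contra hau
    have h1 := Finset.card_filter_add_card_filter_not (s := (Finset.univ : Finset (Fin K)))
      (fun t => l ≤ c t ∧ c t ≤ u)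
    have h2 : (Finset.univ.filter fun t => l ≤ c t ∧ c t ≤ u).card ≤
        (Finset.univ.filter fun t => c t < a).card := by
      refine Finset.card_le_card fun t => ?_
      simp only [Finset.mem_filter, Finset.mem_univ, true_and]
      exact fun h => lt_of_le_of_lt h.2 (not_le.1 hau)
    rw [Finset.card_univ, Fintype.card_fin] at h1
    simp only [Set.mem_ofPred_eq] at ha
    omega
  exact ⟨le_csSup ⟨u, hu⟩ hl, csSup_le ⟨l, hl⟩ hu⟩

/-- Exponential Markov inequality: a bad sample has weight 2 and a good one 1/2, so a word at least
half bad has weight at least 1. The mean weight per sample is at most `1/2 + (3/2)(1/6) = 3/4`. -/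
theorem sum_prod_filter_majority_le {Q : Type*} [Fintype Q] {K : ℕ} (μ : Q → ℝ)
    (h0 : ∀ x, 0 ≤ μ x) (h1 : ∑ x, μ x = 1) (bad : Q → Prop) [DecidablePred bad]
    (hb : ∑ x with bad x, μ x ≤ 1 / 6) :
    ∑ w : Fin K → Q with K ≤ 2 * (Finset.univ.filter fun t => bad (w t)).card, ∏ t, μ (w t) ≤
      (3 / 4) ^ K := by
  classical
  have hkey : ∀ w : Fin K → Q, K ≤ 2 * (Finset.univ.filter fun t => bad (w t)).card →
      (1 : ℝ) ≤ ∏ t, if bad (w t) then (2 : ℝ) else 1 / 2 := by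
    intro w hw
    have h2 := Finset.card_filter_add_card_filter_not (s := (Finset.univ : Finset (Fin K)))
      (fun t => bad (w t))
    rw [Finset.card_univ, Fintype.card_fin] at h2
    rw [Finset.prod_ite, Finset.prod_const, Finset.prod_const, one_div, inv_pow,
      ← div_eq_mul_inv, one_le_div (by positivity)]
    exact pow_le_pow_right₀ (by norm_num) (by omega)
  calc _ ≤ ∑ w : Fin K → Q, ∏ t, (μ (w t) * if bad (w t) then (2 : ℝ) else 1 / 2) := by
        rw [Finset.sum_filter]
        refine Finset.sum_le_sum fun w _ => ?_
        have hp : 0 ≤ ∏ t, μ (w t) := Finset.prod_nonneg fun t _ => h0 _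
        rw [Finset.prod_mul_distrib]
        split_ifs with h
        · exact le_mul_of_one_le_right hp (hkey w h)
        · exact mul_nonneg hp (Finset.prod_nonneg fun t _ => by split_ifs <;> norm_num)
    _ = (∑ x, μ x * if bad x then (2 : ℝ) else 1 / 2) ^ K := by
        rw [Fintype.sum_pow]
    _ ≤ (3 / 4) ^ K := by
        apply pow_le_pow_left₀
        · exact Finset.sum_nonneg fun x _ => mul_nonneg (h0 x) (by split_ifs <;> norm_num)
        · have : ∑ x, (μ x * if bad x then (2 : ℝ) else 1 / 2) =
              1 / 2 * ∑ x, μ x + 3 / 2 * ∑ x with bad x, μ x := by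
            rw [Finset.sum_filter, Finset.mul_sum, Finset.mul_sum, ← Finset.sum_add_distrib]
            refine Finset.sum_congr rfl fun x _ => ?_
            split_ifs <;> ring
          rw [this, h1]
          linarith

/-- Union bound over the coordinates. -/
theorem one_sub_le_sum_indicator {Ω : Type*} [Fintype Ω] {d : ℕ} (ν : Ω → ℝ) (h0 : ∀ x, 0 ≤ ν x)
    (h1 : ∑ x, ν x = 1) (bad : Fin d → Ω → Prop) [∀ j, DecidablePred (bad j)] (η : ℝ)
    (hb : ∀ j, ∑ x with bad j x, ν x ≤ η) (E : Set Ω) (hE : ∀ x, (∀ j, ¬ bad j x) → x ∈ E) :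
    1 - d * η ≤ ∑ x, E.indicator ν x := by
  classical
  have h2 : ∑ x, ν x ≤ ∑ x, (E.indicator ν x + ∑ j, if bad j x then ν x else 0) := by
    refine Finset.sum_le_sum fun x _ => ?_
    have h3 : ∀ j ∈ (Finset.univ : Finset (Fin d)), 0 ≤ if bad j x then ν x else 0 :=
      fun j _ => by split_ifs <;> simp [h0]
    have h4 := Finset.sum_nonneg h3
    by_cases h : x ∈ E
    · rw [Set.indicator_of_mem h]; linarith
    · have : ∃ j, bad j x := by
        by_contra hne
        exact h (hE x (not_exists.1 hne))
      obtain ⟨j, hj⟩ := this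
      rw [Set.indicator_of_notMem h, zero_add]
      refine le_trans ?_ (Finset.single_le_sum h3 (Finset.mem_univ j))
      rw [if_pos hj]
  rw [Finset.sum_add_distrib, Finset.sum_comm, h1] at h2
  have h5 : ∑ j, ∑ x, (if bad j x then ν x else 0) ≤ d * η := by
    refine (Finset.sum_le_sum fun j _ => ?_).trans (b := ∑ _j : Fin d, η) (by simp)
    rw [← Finset.sum_filter]; exact hb j
  linarith

theorem sum_prod_filter_coord {I : Type*} [Fintype I] [DecidableEq I] {d : ℕ} (f : Fin d → I → ℝ)
    (h1 : ∀ j, ∑ x, f j x = 1) (j : Fin d) (bad : I → Prop) [DecidablePred bad] :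
    ∑ k : Fin d → I with bad (k j), ∏ i, f i (k i) = ∑ x with bad x, f j x := by
  classical
  have h : ∀ k : Fin d → I, (if bad (k j) then ∏ i, f i (k i) else 0) =
      ∏ i, (if i = j then (if bad (k i) then f i (k i) else 0) else f i (k i)) := by
    intro k
    split_ifs with hk
    · refine Finset.prod_congr rfl fun i _ => ?_
      split_ifs with hi hb
      · rfl
      · subst hi; exact absurd hk hb
      · rfl
    · rw [Finset.prod_eq_zero (Finset.mem_univ j)]
      simp [hk]
  rw [Finset.sum_filter, Finset.sum_congr rfl fun k _ => h k]
  have h2 := (Finset.prod_univ_sum (fun _ : Fin d => (Finset.univ : Finset I))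
    (fun i x => if i = j then (if bad x then f i x else 0) else f i x)).symm
  rw [Fintype.piFinset_univ] at h2
  rw [h2, Finset.prod_eq_single j]
  · simp [Finset.sum_filter]
  · intro i _ hi
    simp [hi, h1]
  · simp

end Median

/-! ### Concentration and anti-concentration of linear forms on the grid -/

section Grid

theorem gridPoint_rev {N : ℕ} (z : Fin N) : gridPoint N (Fin.rev z) = -gridPoint N z := by
  have hz : ((z : ℕ) : ℝ) + 1 ≤ N := by exact_mod_cast z.2
  simp only [gridPoint, Fin.val_rev]
  rw [Nat.cast_sub z.2]
  push_cast
  ring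

theorem abs_gridPoint_le {N : ℕ} (z : Fin N) : |gridPoint N z| ≤ 1 / 2 := by
  have hz : ((z : ℕ) : ℝ) + 1 ≤ N := by exact_mod_cast z.2
  have h0 : (0 : ℝ) ≤ ((z : ℕ) : ℝ) := by positivity
  have hN : (0 : ℝ) < N := by linarith
  rw [gridPoint, abs_div, abs_of_pos hN, div_le_iff₀ hN, abs_le]
  constructor <;> linarith

theorem sum_gridPoint_neg {N : ℕ} (f : ℝ → ℝ) :
    ∑ z : Fin N, f (-gridPoint N z) = ∑ z : Fin N, f (gridPoint N z) := by
  rw [← Equiv.sum_comp Fin.revPerm]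
  refine Finset.sum_congr rfl fun z _ => ?_
  rw [Fin.revPerm_apply, gridPoint_rev, neg_neg]

/-- Hoeffding's lemma: symmetry turns `exp` into `cosh`, and `cosh (s/2) ≤ exp (s²/8)`. -/
theorem sum_exp_gridPoint_le (N : ℕ) (s : ℝ) :
    ∑ z : Fin N, Real.exp (s * gridPoint N z) ≤ N * Real.exp (s ^ 2 / 8) := by
  have h1 := sum_gridPoint_neg (N := N) fun x => Real.exp (s * x)
  have h2 : ∑ z : Fin N, Real.exp (s * gridPoint N z) =
      ∑ z : Fin N, Real.cosh (s * gridPoint N z) := by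
    have : ∀ z : Fin N, Real.cosh (s * gridPoint N z) =
        (Real.exp (s * gridPoint N z) + Real.exp (s * -gridPoint N z)) / 2 := by
      intro z; rw [Real.cosh_eq, mul_neg]
    simp_rw [this]
    rw [← Finset.sum_div, Finset.sum_add_distrib, h1]
    ring
  rw [h2]
  refine (Finset.sum_le_sum fun z _ => ?_).trans (b := ∑ _z : Fin N, Real.exp (s ^ 2 / 8))
    (by simp)
  refine le_trans (b := Real.cosh (s / 2)) (Real.cosh_le_cosh.2 ?_) ?_
  · rw [abs_mul, abs_div, abs_two]
    nlinarith [abs_nonneg s, abs_gridPoint_le z]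
  · refine (Real.cosh_le_exp_half_sq _).trans (le_of_eq ?_)
    congr 1; ring

/-- Exponential Markov inequality over the grid, one-sided. -/
theorem card_grid_ge_le {N d : ℕ} (a : Fin d → ℝ) (D t : ℝ) (hD : 0 < D) (ht : 0 ≤ t)
    (ha : ∑ j, a j ^ 2 ≤ D ^ 2) :
    ((Finset.univ.filter fun k : Fin d → Fin N =>
      t ≤ ∑ j, gridPoint N (k j) * a j).card : ℝ) ≤
      (N : ℝ) ^ d * Real.exp (-(2 * t ^ 2 / D ^ 2)) := by
  -- The minimiser of the exponent `-l t + l² D² / 8`.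
  set l : ℝ := 4 * t / D ^ 2 with hl
  calc ((Finset.univ.filter fun k : Fin d → Fin N =>
      t ≤ ∑ j, gridPoint N (k j) * a j).card : ℝ)
      = ∑ k : Fin d → Fin N, if t ≤ ∑ j, gridPoint N (k j) * a j then (1 : ℝ) else 0 := by
        rw [Finset.sum_boole]
    _ ≤ ∑ k : Fin d → Fin N, Real.exp (-(l * t)) *
          ∏ j, Real.exp (l * a j * gridPoint N (k j)) := by
        refine Finset.sum_le_sum fun k _ => ?_
        rw [← Real.exp_sum, ← Real.exp_add]
        have h1 : -(l * t) + ∑ j, l * a j * gridPoint N (k j) =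
            l * (∑ j, gridPoint N (k j) * a j - t) := by
          rw [mul_sub, Finset.mul_sum]
          have : ∀ j, l * (gridPoint N (k j) * a j) = l * a j * gridPoint N (k j) :=
            fun j => by ring
          simp_rw [this]; ring
        rw [h1]
        split_ifs with h
        · apply Real.one_le_exp
          exact mul_nonneg (by positivity) (by linarith)
        · positivity
    _ = Real.exp (-(l * t)) * ∏ j, ∑ z : Fin N, Real.exp (l * a j * gridPoint N z) := by
        rw [← Finset.mul_sum, Finset.prod_univ_sum, Fintype.piFinset_univ]
    _ ≤ Real.exp (-(l * t)) * ∏ j, (N * Real.exp ((l * a j) ^ 2 / 8)) := by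
        gcongr with j _
        exact sum_exp_gridPoint_le N _
    _ = (N : ℝ) ^ d * Real.exp (-(l * t) + l ^ 2 / 8 * ∑ j, a j ^ 2) := by
        rw [Finset.prod_mul_distrib, Finset.prod_const, Finset.card_univ, Fintype.card_fin,
          ← Real.exp_sum, Real.exp_add, Finset.mul_sum]
        have : ∀ j, (l * a j) ^ 2 / 8 = l ^ 2 / 8 * a j ^ 2 := fun j => by ring
        simp_rw [this]; ring
    _ ≤ (N : ℝ) ^ d * Real.exp (-(2 * t ^ 2 / D ^ 2)) := by
        gcongr
        have h1 : l ^ 2 / 8 * ∑ j, a j ^ 2 ≤ l ^ 2 / 8 * D ^ 2 := by gcongr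
        have h2 : -(l * t) + l ^ 2 / 8 * D ^ 2 = -(2 * t ^ 2 / D ^ 2) := by
          rw [hl]; field_simp; ring
        linarith

theorem card_grid_abs_ge_le {N d : ℕ} (a : Fin d → ℝ) (D t : ℝ) (hD : 0 < D) (ht : 0 ≤ t)
    (ha : ∑ j, a j ^ 2 ≤ D ^ 2) :
    ((Finset.univ.filter fun k : Fin d → Fin N =>
      t ≤ |∑ j, gridPoint N (k j) * a j|).card : ℝ) ≤
      (N : ℝ) ^ d * (2 * Real.exp (-(2 * t ^ 2 / D ^ 2))) := by
  have h1 := card_grid_ge_le (N := N) a D t hD ht ha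
  have h2 := card_grid_ge_le (N := N) (fun j => -a j) D t hD ht (by simpa using ha)
  have h3 : (Finset.univ.filter fun k : Fin d → Fin N => t ≤ |∑ j, gridPoint N (k j) * a j|) ⊆
      (Finset.univ.filter fun k : Fin d → Fin N => t ≤ ∑ j, gridPoint N (k j) * a j) ∪
      (Finset.univ.filter fun k : Fin d → Fin N => t ≤ ∑ j, gridPoint N (k j) * -a j) := by
    intro k
    simp only [Finset.mem_filter, Finset.mem_union, Finset.mem_univ, true_and, mul_neg,
      Finset.sum_neg_distrib]
    exact le_abs.1
  have h4 : ((Finset.univ.filter fun k : Fin d → Fin N =>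
      t ≤ |∑ j, gridPoint N (k j) * a j|).card : ℝ) ≤ _ :=
    Nat.cast_le.2 ((Finset.card_le_card h3).trans (Finset.card_union_le _ _))
  push_cast at h4
  linarith

theorem card_nat_dist_lt_le (s : Finset ℕ) (c ρ : ℝ) (hρ : 0 ≤ ρ)
    (hs : ∀ z ∈ s, |(z : ℝ) - c| < ρ) : (s.card : ℝ) ≤ 2 * ρ + 1 := by
  rcases s.eq_empty_or_nonempty with rfl | hne
  · simp; linarith
  · have h1 : s ⊆ Finset.Icc (s.min' hne) (s.max' hne) := fun z hz =>
      Finset.mem_Icc.2 ⟨s.min'_le z hz, s.le_max' z hz⟩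
    have h2 := Finset.card_le_card h1
    have h5 : s.min' hne ≤ s.max' hne := s.min'_le_max' hne
    rw [Nat.card_Icc, show s.max' hne + 1 - s.min' hne = (s.max' hne - s.min' hne) + 1 by
      omega] at h2
    have h6 : (s.card : ℝ) ≤ ((s.max' hne : ℝ) - s.min' hne) + 1 := by
      rw [← Nat.cast_sub h5]; exact_mod_cast h2
    have h3 := abs_lt.1 (hs _ (s.min'_mem hne))
    have h4 := abs_lt.1 (hs _ (s.max'_mem hne))
    linarith [h3.1, h3.2, h4.1, h4.2]

/-- With all other coordinates fixed, the index `k j` is confined to an interval of radius `N / (60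
|a j|) ≤ N / 5`. It takes at most `2N/5 + 1 < N/2` values. -/
theorem card_grid_small_of_large_coeff {N d : ℕ} (hN : 32 ≤ N) (a : Fin d → ℝ) (j : Fin d)
    (hj : 1 / 12 ≤ |a j|) :
    ((Finset.univ.filter fun k : Fin d → Fin N =>
      |∑ i, gridPoint N (k i) * a i| < 1 / 60).card : ℝ) < (N : ℝ) ^ d / 2 := by
  have hN' : (32 : ℝ) ≤ N := by exact_mod_cast hN
  have ha : a j ≠ 0 := abs_pos.1 (lt_of_lt_of_le (by norm_num) hj)
  set s := Finset.univ.filter fun k : Fin d → Fin N =>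
    |∑ i, gridPoint N (k i) * a i| < 1 / 60 with hs
  obtain ⟨m, hm⟩ : ∃ m : ℕ, m = ⌊2 * ((N : ℝ) / 5) + 1⌋₊ := ⟨_, rfl⟩
  have h1 : s.card ≤ m * (Finset.univ : Finset ({i // i ≠ j} → Fin N)).card := by
    refine Finset.card_le_mul_card_image_of_maps_to
      (f := fun (k : Fin d → Fin N) (i : {i // i ≠ j}) => k i) (fun _ _ => Finset.mem_univ _) m
      fun b _ => ?_
    set T := s.filter fun k : Fin d → Fin N => (fun i : {i // i ≠ j} => k i) = b with hT
    set f : (Fin d → Fin N) → ℕ := fun k => k j with hf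
    have hinj : Set.InjOn f T := by
      intro k hk l hl h
      have hk' := (Finset.mem_filter.1 (Finset.mem_coe.1 hk)).2
      have hl' := (Finset.mem_filter.1 (Finset.mem_coe.1 hl)).2
      funext i
      by_cases hi : i = j
      · subst hi; exact Fin.ext h
      · exact congrFun (hk'.trans hl'.symm) ⟨i, hi⟩
    rw [← Finset.card_image_of_injOn hinj]
    rw [hm]
    apply Nat.le_floor
    set rest : ℝ := ∑ i : {i // i ≠ j}, gridPoint N (b i) * a i with hrest
    refine card_nat_dist_lt_le _ (-(-((N : ℝ) / 2) + 1 / 2) - N * rest / a j) _ (by positivity) ?_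
    intro z hz
    obtain ⟨k, hk, rfl⟩ := Finset.mem_image.1 hz
    obtain ⟨hk1, hk2⟩ := Finset.mem_filter.1 hk
    have hk3 := (Finset.mem_filter.1 hk1).2
    have hsum : ∑ i, gridPoint N (k i) * a i = gridPoint N (k j) * a j + rest := by
      rw [Fintype.sum_eq_add_sum_subtype_ne _ j, hrest, ← hk2]
    rw [hsum] at hk3
    have h1 : ((k j : ℕ) : ℝ) - (-(-((N : ℝ) / 2) + 1 / 2) - N * rest / a j) =
        N / a j * (gridPoint N (k j) * a j + rest) := by
      simp only [gridPoint]; field_simp; ring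
    simp only [hf]
    rw [h1, abs_mul, abs_div, Nat.abs_cast]
    have h2 : (N : ℝ) / |a j| ≤ 12 * N := by
      rw [div_le_iff₀ (by positivity)]; nlinarith
    calc (N : ℝ) / |a j| * |gridPoint N (k j) * a j + rest|
        ≤ 12 * N * |gridPoint N (k j) * a j + rest| := by gcongr
      _ < 12 * N * (1 / 60) := by gcongr
      _ = N / 5 := by ring
  have hcard : (Finset.univ : Finset ({i // i ≠ j} → Fin N)).card = N ^ (d - 1) := by
    rw [Finset.card_univ, Fintype.card_fun, Fintype.card_fin, Fintype.card_subtype_compl,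
      Fintype.card_fin, Fintype.card_subtype_eq]
  rw [hcard] at h1
  have h2 : (s.card : ℝ) ≤ m * (N : ℝ) ^ (d - 1) := by exact_mod_cast h1
  have h3 : (m : ℝ) ≤ 2 * ((N : ℝ) / 5) + 1 := by rw [hm]; exact Nat.floor_le (by positivity)
  have h4 : (0 : ℝ) < (N : ℝ) ^ (d - 1) := by positivity
  have h5 : (m : ℝ) * (N : ℝ) ^ (d - 1) < N / 2 * (N : ℝ) ^ (d - 1) :=
    mul_lt_mul_of_pos_right (by linarith) h4
  have h6 : (N : ℝ) ^ d = (N : ℝ) ^ (d - 1) * N := (pow_sub_one_mul j.pos.ne' _).symm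
  rw [h6]
  calc (s.card : ℝ) ≤ _ := h2
    _ < _ := h5
    _ = _ := by ring

/-- The characteristic function of a sum of independent coordinates factorises, and each factor is
real by symmetry of the grid. -/
theorem sum_cos_grid {N d : ℕ} (a : Fin d → ℝ) (t : ℝ) :
    ∑ k : Fin d → Fin N, Real.cos (t * ∑ j, gridPoint N (k j) * a j) =
      ∏ j, ∑ z : Fin N, Real.cos (t * a j * gridPoint N z) := by
  have h1 : ∀ s : ℝ, ∑ z : Fin N, Complex.exp ((s * gridPoint N z : ℝ) * Complex.I) =
      ((∑ z : Fin N, Real.cos (s * gridPoint N z) : ℝ) : ℂ) := by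
    intro s
    have h2 := sum_gridPoint_neg (N := N) fun x => Real.sin (s * x)
    simp only [mul_neg, Real.sin_neg, Finset.sum_neg_distrib] at h2
    have h3 : ∑ z : Fin N, Real.sin (s * gridPoint N z) = 0 := by linarith
    apply Complex.ext
    · simp only [Complex.re_sum, Complex.exp_ofReal_mul_I_re, Complex.ofReal_re]
    · simp only [Complex.im_sum, Complex.exp_ofReal_mul_I_im, Complex.ofReal_im, h3]
  have h4 : ∑ k : Fin d → Fin N,
      Complex.exp ((t * ∑ j, gridPoint N (k j) * a j : ℝ) * Complex.I) =
      ((∏ j, ∑ z : Fin N, Real.cos (t * a j * gridPoint N z) : ℝ) : ℂ) := by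
    rw [Complex.ofReal_prod]
    simp_rw [← h1]
    rw [Finset.prod_univ_sum, Fintype.piFinset_univ]
    refine Finset.sum_congr rfl fun k _ => ?_
    rw [← Complex.exp_sum, ← Finset.sum_mul, ← Complex.ofReal_sum, Finset.mul_sum]
    congr 3
    exact Finset.sum_congr rfl fun j _ => by ring
  have h5 := congrArg Complex.re h4
  simpa only [Complex.re_sum, Complex.exp_ofReal_mul_I_re, Complex.ofReal_re] using h5

theorem sum_gridPoint_sq {N : ℕ} (hN : 0 < N) :
    ∑ z : Fin N, gridPoint N z ^ 2 = ((N : ℝ) ^ 2 - 1) / (12 * N) := by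
  have h1 : ∀ (m : ℕ) (c : ℝ), ∑ z ∈ Finset.range m, (c + z) ^ 2 =
      (m : ℝ) * (m - 1) * (2 * m - 1) / 6 + c * m * (m - 1) + m * c ^ 2 := by
    intro m c
    induction m with
    | zero => simp
    | succ m ih => rw [Finset.sum_range_succ, ih]; push_cast; ring
  have hN' : (0 : ℝ) < N := by exact_mod_cast hN
  rw [Fin.sum_univ_eq_sum_range (fun z => gridPoint N z ^ 2)]
  simp only [gridPoint, div_pow]
  rw [← Finset.sum_div, h1]
  field_simp
  ring

/-- Here `cos x ≤ 1 - x²/5` for the arguments in question, and the grid has variance at least 1/13;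
hence `65 = 5 · 13`. Nonnegativity allows the bounds to be multiplied over coordinates. -/
theorem sum_cos_gridPoint_mem {N : ℕ} (hN : 32 ≤ N) (s : ℝ) (hs : |s| ≤ 2) :
    0 ≤ ∑ z : Fin N, Real.cos (s * gridPoint N z) ∧
      ∑ z : Fin N, Real.cos (s * gridPoint N z) ≤ N * Real.exp (-(s ^ 2 / 65)) := by
  have hN' : (32 : ℝ) ≤ N := by exact_mod_cast hN
  have hpi := Real.pi_gt_three
  have hpi' := Real.pi_lt_d2
  have hx : ∀ z : Fin N, |s * gridPoint N z| ≤ 1 := by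
    intro z
    rw [abs_mul]
    nlinarith [abs_gridPoint_le z, abs_nonneg s, abs_nonneg (gridPoint N z)]
  constructor
  · refine Finset.sum_nonneg fun z _ => Real.cos_nonneg_of_mem_Icc ?_
    have := abs_le.1 (hx z)
    constructor <;> linarith [this.1, this.2]
  · have h1 : ∀ z : Fin N, Real.cos (s * gridPoint N z) ≤ 1 - 1 / 5 * s ^ 2 * gridPoint N z ^ 2 := by
      intro z
      have h2 := Real.cos_le_one_sub_mul_cos_sq (x := s * gridPoint N z) (by linarith [hx z])
      have h3 : 1 / 5 ≤ 2 / Real.pi ^ 2 := by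
        rw [div_le_div_iff₀ (by norm_num) (by positivity)]; nlinarith
      have h4 : 0 ≤ (s * gridPoint N z) ^ 2 := sq_nonneg _
      nlinarith
    have h5 : ∑ z : Fin N, Real.cos (s * gridPoint N z) ≤
        N - 1 / 5 * s ^ 2 * (((N : ℝ) ^ 2 - 1) / (12 * N)) := by
      refine (Finset.sum_le_sum fun z _ => h1 z).trans (le_of_eq ?_)
      rw [Finset.sum_sub_distrib, ← Finset.mul_sum, sum_gridPoint_sq (by omega)]
      simp
    have h6 : (N : ℝ) / 13 ≤ ((N : ℝ) ^ 2 - 1) / (12 * N) := by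
      rw [div_le_div_iff₀ (by norm_num) (by positivity)]; nlinarith
    have h7 : 1 - s ^ 2 / 65 ≤ Real.exp (-(s ^ 2 / 65)) := by
      linarith [Real.add_one_le_exp (-(s ^ 2 / 65))]
    nlinarith [mul_le_mul_of_nonneg_left h6 (sq_nonneg s),
      mul_le_mul_of_nonneg_left h7 (by linarith : (0 : ℝ) ≤ N)]

theorem sum_cos_grid_le {N d : ℕ} (hN : 32 ≤ N) (a : Fin d → ℝ) (ha : ∑ j, a j ^ 2 = 1)
    (ha' : ∀ j, |a j| ≤ 1 / 12) (t : ℝ) (h12 : 12 ≤ t) (h24 : t ≤ 24) :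
    ∑ k : Fin d → Fin N, Real.cos (t * ∑ j, gridPoint N (k j) * a j) ≤ (N : ℝ) ^ d / 5 := by
  have hs : ∀ j, |t * a j| ≤ 2 := by
    intro j
    rw [abs_mul, abs_of_nonneg (by linarith : 0 ≤ t)]
    nlinarith [ha' j, abs_nonneg (a j)]
  rw [sum_cos_grid]
  calc ∏ j, ∑ z : Fin N, Real.cos (t * a j * gridPoint N z)
      ≤ ∏ j : Fin d, (N * Real.exp (-((t * a j) ^ 2 / 65))) :=
        Finset.prod_le_prod (fun j _ => (sum_cos_gridPoint_mem hN _ (hs j)).1)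
          fun j _ => (sum_cos_gridPoint_mem hN _ (hs j)).2
    _ = (N : ℝ) ^ d * Real.exp (-(t ^ 2 / 65)) := by
        rw [Finset.prod_mul_distrib, Finset.prod_const, Finset.card_univ, Fintype.card_fin,
          ← Real.exp_sum]
        congr 2
        have : ∀ j, -((t * a j) ^ 2 / 65) = -(t ^ 2 / 65) * a j ^ 2 := fun j => by ring
        simp_rw [this]
        rw [← Finset.mul_sum, ha, mul_one]
    _ ≤ (N : ℝ) ^ d / 5 := by
        have h1 : Real.exp (-(t ^ 2 / 65)) ≤ Real.exp (-2) := Real.exp_le_exp.2 (by nlinarith)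
        have h2 : Real.exp (-2) ≤ 1 / 5 := by
          have h3 := Real.quadratic_le_exp_of_nonneg (x := 2) (by norm_num)
          rw [Real.exp_neg, one_div]
          exact inv_anti₀ (by norm_num) (by linarith)
        have h3 : (0 : ℝ) < (N : ℝ) ^ d := by positivity
        nlinarith [h1.trans h2]

/-- If no coefficient is large, the nonnegative Fejér kernel `(1 + 2 cos 12x)² / 3` is tested
against the grid. It is at least 2.9 for `|x| < 1/60`, while its mean is at most `1 + (4/3 + 2/3)/5
= 1.4`; the fraction is at most `1.4 / 2.9 < 1/2`. -/
theorem card_grid_small {N d : ℕ} (hN : 32 ≤ N) (a : Fin d → ℝ) (ha : ∑ j, a j ^ 2 = 1) :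
    ((Finset.univ.filter fun k : Fin d → Fin N =>
      |∑ i, gridPoint N (k i) * a i| < 1 / 60).card : ℝ) < (N : ℝ) ^ d / 2 := by
  have hN' : (32 : ℝ) ≤ N := by exact_mod_cast hN
  by_cases h : ∃ j, 1 / 12 ≤ |a j|
  · obtain ⟨j, hj⟩ := h
    exact card_grid_small_of_large_coeff hN a j hj
  · have ha' : ∀ j, |a j| ≤ 1 / 12 := fun j => le_of_not_ge fun hj => h ⟨j, hj⟩
    have h12 := sum_cos_grid_le hN a ha ha' 12 le_rfl (by norm_num)
    have h24 := sum_cos_grid_le hN a ha ha' 24 (by norm_num) le_rfl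
    set s := Finset.univ.filter fun k : Fin d → Fin N =>
      |∑ i, gridPoint N (k i) * a i| < 1 / 60 with hs
    have h1 : (s.card : ℝ) * (29 / 10) ≤ ∑ k : Fin d → Fin N,
        (1 + 4 / 3 * Real.cos (12 * ∑ j, gridPoint N (k j) * a j) +
          2 / 3 * Real.cos (24 * ∑ j, gridPoint N (k j) * a j)) := by
      rw [← nsmul_eq_mul, ← Finset.sum_const]
      have hpt : ∀ x : ℝ, 1 + 4 / 3 * Real.cos (12 * x) + 2 / 3 * Real.cos (24 * x) =
          (1 + 2 * Real.cos (12 * x)) ^ 2 / 3 := by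
        intro x
        rw [show 24 * x = 2 * (12 * x) by ring, Real.cos_two_mul]; ring
      simp_rw [hpt]
      refine (Finset.sum_le_sum fun k hk => ?_).trans
        (Finset.sum_le_sum_of_subset_of_nonneg (Finset.subset_univ s) fun _ _ _ => by positivity)
      have hk' := abs_lt.1 (Finset.mem_filter.1 hk).2
      have h2 := Real.one_sub_sq_div_two_le_cos (x := 12 * ∑ j, gridPoint N (k j) * a j)
      have h3 : 49 / 50 ≤ Real.cos (12 * ∑ j, gridPoint N (k j) * a j) := by
        nlinarith [hk'.1, hk'.2]
      nlinarith
    rw [Finset.sum_add_distrib, Finset.sum_add_distrib, ← Finset.mul_sum, ← Finset.mul_sum] at h1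
    simp only [Finset.sum_const, Finset.card_univ, Fintype.card_fun, Fintype.card_fin,
      nsmul_eq_mul, mul_one, Nat.cast_pow] at h1
    have h5 : (0 : ℝ) < (N : ℝ) ^ d := by positivity
    linarith

end Grid

/-! ### Comparison of `ℓ_p`-norms -/

section Norms

theorem one_le_toReal {q : ℝ≥0∞} (hq : 1 ≤ q) (hq' : q ≠ ⊤) : 1 ≤ q.toReal := by
  simpa using ENNReal.toReal_mono hq' hq

theorem recip_nonneg (q : ℝ≥0∞) : 0 ≤ recip q := ENNReal.toReal_nonneg

theorem recip_eq (q : ℝ≥0∞) : recip q = 1 / q.toReal := by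
  rw [recip, ENNReal.toReal_inv, one_div]

theorem lpNorm_nonneg {d : ℕ} {q : ℝ≥0∞} (hq : 1 ≤ q) (y : Fin d → ℝ) : 0 ≤ lpNorm q y := by
  have : Fact (1 ≤ q) := ⟨hq⟩
  exact norm_nonneg _

theorem abs_le_lpNorm {d : ℕ} {q : ℝ≥0∞} (hq : 1 ≤ q) (y : Fin d → ℝ) (j : Fin d) :
    |y j| ≤ lpNorm q y := by
  have : Fact (1 ≤ q) := ⟨hq⟩
  exact PiLp.norm_apply_le (WithLp.toLp q y) j

theorem lpNorm_eq {d : ℕ} {q : ℝ≥0∞} (hq : 1 ≤ q) (hq' : q ≠ ⊤) (y : Fin d → ℝ) :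
    lpNorm q y = (∑ j, |y j| ^ q.toReal) ^ (1 / q.toReal) := by
  rw [lpNorm, PiLp.norm_eq_sum (by linarith [one_le_toReal hq hq'])]
  rfl

theorem lpNorm_single {d : ℕ} {q : ℝ≥0∞} (hq : 1 ≤ q) (j : Fin d) :
    lpNorm q (Pi.single j 1 : Fin d → ℝ) ≤ 1 := by
  have : Fact (1 ≤ q) := ⟨hq⟩
  exact ((PiLp.norm_single q (fun _ : Fin d => ℝ) j (1 : ℝ)).trans norm_one).le

theorem lpNorm_le_of_forall_abs_le {d : ℕ} {p : ℝ≥0∞} (hp : 1 ≤ p) (v : Fin d → ℝ) (c : ℝ)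
    (hc : 0 ≤ c) (hv : ∀ j, |v j| ≤ c) : lpNorm p v ≤ (d : ℝ) ^ recip p * c := by
  by_cases hp' : p = ⊤
  · subst hp'
    have : lpNorm ⊤ v = ‖v‖ := PiLp.norm_toLp v
    rw [this, recip, ENNReal.inv_top, ENNReal.toReal_zero, Real.rpow_zero, one_mul]
    exact (pi_norm_le_iff_of_nonneg hc).2 hv
  · have h1 := one_le_toReal hp hp'
    have h0 : 0 < p.toReal := by linarith
    rw [lpNorm_eq hp hp', recip_eq]
    calc (∑ j, |v j| ^ p.toReal) ^ (1 / p.toReal)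
        ≤ ((d : ℝ) * c ^ p.toReal) ^ (1 / p.toReal) := by
          apply Real.rpow_le_rpow (Finset.sum_nonneg fun j _ => by positivity) _ (by positivity)
          refine (Finset.sum_le_sum fun j _ => ?_).trans (b := ∑ _j : Fin d, c ^ p.toReal)
            (by simp)
          exact Real.rpow_le_rpow (abs_nonneg _) (hv j) h0.le
      _ = (d : ℝ) ^ (1 / p.toReal) * c := by
          rw [Real.mul_rpow (by positivity) (by positivity), ← Real.rpow_mul hc,
            mul_one_div_cancel h0.ne', Real.rpow_one]

/-- For `q ≤ 2`, interpolation with `|y j| ≤ ‖y‖_q`; for finite `q ≥ 2`, the power mean inequality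
with exponent `q/2`. -/
theorem sum_sq_le_lpNorm {d : ℕ} (hd : 1 ≤ d) {q : ℝ≥0∞} (hq : 1 ≤ q) (y : Fin d → ℝ) :
    ∑ j, y j ^ 2 ≤ ((d : ℝ) ^ max 0 (1 / 2 - recip q) * lpNorm q y) ^ 2 := by
  have hA := lpNorm_nonneg hq y
  have hd' : (0 : ℝ) < d := by exact_mod_cast hd
  by_cases hq' : q = ⊤
  · subst hq'
    have h1 : max 0 (1 / 2 - recip ⊤) = (1 / 2 : ℝ) := by
      rw [recip, ENNReal.inv_top, ENNReal.toReal_zero]; norm_num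
    rw [h1, mul_pow, ← Real.sqrt_eq_rpow, Real.sq_sqrt hd'.le]
    refine (Finset.sum_le_sum fun j _ => ?_).trans (b := ∑ _j : Fin d, lpNorm ⊤ y ^ 2) (by simp)
    rw [← sq_abs]
    exact pow_le_pow_left₀ (abs_nonneg _) (abs_le_lpNorm hq y j) 2
  have h1 := one_le_toReal hq hq'
  have hAr : ∑ j, |y j| ^ q.toReal = lpNorm q y ^ q.toReal := by
    rw [lpNorm_eq hq hq', ← Real.rpow_mul (Finset.sum_nonneg fun j _ => by positivity),
      one_div_mul_cancel (by linarith), Real.rpow_one]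
  rcases le_total q.toReal 2 with h2 | h2
  · have h3 : max 0 (1 / 2 - recip q) = (0 : ℝ) := by
      apply max_eq_left
      rw [recip_eq, sub_nonpos]
      exact one_div_le_one_div_of_le (by linarith) h2
    rw [h3, Real.rpow_zero, one_mul]
    calc ∑ j, y j ^ 2 ≤ ∑ j, |y j| ^ q.toReal * lpNorm q y ^ (2 - q.toReal) := by
          refine Finset.sum_le_sum fun j _ => ?_
          have h4 : y j ^ 2 = |y j| ^ q.toReal * |y j| ^ (2 - q.toReal) := by
            rw [← Real.rpow_add_of_nonneg (abs_nonneg _) (by linarith) (by linarith),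
              add_sub_cancel, Real.rpow_two, sq_abs]
          rw [h4]
          gcongr
          exact abs_le_lpNorm hq y j
      _ = lpNorm q y ^ 2 := by
          rw [← Finset.sum_mul, hAr, ← Real.rpow_add_of_nonneg hA (by linarith) (by linarith),
            add_sub_cancel, Real.rpow_two]
  · have h3 : max 0 (1 / 2 - recip q) = (1 / 2 - 1 / q.toReal : ℝ) := by
      rw [recip_eq]
      apply max_eq_right
      rw [sub_nonneg]
      exact one_div_le_one_div_of_le (by norm_num) h2
    rw [h3]
    have h4 := Real.rpow_sum_le_const_mul_sum_rpow_of_nonneg (s := (Finset.univ : Finset (Fin d)))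
      (f := fun j => y j ^ 2) (p := q.toReal / 2) (by linarith) (fun j _ => sq_nonneg _)
    have h5 : ∀ j, (y j ^ 2) ^ (q.toReal / 2) = |y j| ^ q.toReal := by
      intro j
      rw [← sq_abs, ← Real.rpow_natCast, ← Real.rpow_mul (abs_nonneg _)]
      congr 1; push_cast; ring
    simp_rw [h5] at h4
    rw [hAr, Finset.card_univ, Fintype.card_fin] at h4
    have hs : 0 ≤ ∑ j, y j ^ 2 := Finset.sum_nonneg fun j _ => sq_nonneg _
    have hq0 : q.toReal ≠ 0 := by linarith
    have h6 : ∑ j, y j ^ 2 = ((∑ j, y j ^ 2) ^ (q.toReal / 2)) ^ (2 / q.toReal) := by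
      rw [← Real.rpow_mul hs, div_mul_div_comm, mul_comm, div_self (by positivity), Real.rpow_one]
    rw [h6]
    refine (Real.rpow_le_rpow (by positivity) h4 (by positivity)).trans (le_of_eq ?_)
    rw [Real.mul_rpow (by positivity) (by positivity), ← Real.rpow_mul hd'.le,
      ← Real.rpow_mul hA, mul_pow, ← Real.rpow_natCast ((d : ℝ) ^ _), ← Real.rpow_mul hd'.le]
    congr 1
    · congr 1; push_cast; field_simp
    · rw [mul_div_cancel₀ _ hq0, Real.rpow_two]

end Norms

/-! ### Bounds on the effective radius of the rotated grid -/

section Radius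

variable {d : ℕ} (O : Matrix.orthogonalGroup (Fin d) ℝ) (n : ℕ)

/-- The point of the rotated grid with the given index. -/
noncomputable def rotatedPoint (k : Fin d → Fin (2 ^ n)) : Fin d → ℝ :=
  (O : Matrix (Fin d) (Fin d) ℝ)ᵀ *ᵥ fun j => gridPoint (2 ^ n) (k j)

theorem rotatedGrid_eq_image :
    rotatedGrid (O : Matrix (Fin d) (Fin d) ℝ) n = Finset.univ.image (rotatedPoint O n) := by
  unfold rotatedGrid
  congr 1
  funext k
  simp only [rotatedPoint, gridPoint, Nat.cast_pow, Nat.cast_ofNat]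

theorem orthogonal_mul_transpose :
    (O : Matrix (Fin d) (Fin d) ℝ) * (O : Matrix (Fin d) (Fin d) ℝ)ᵀ = 1 :=
  (Matrix.mem_orthogonalGroup_iff _ _).1 O.2

theorem orthogonal_transpose_mul :
    (O : Matrix (Fin d) (Fin d) ℝ)ᵀ * (O : Matrix (Fin d) (Fin d) ℝ) = 1 :=
  (Matrix.mem_orthogonalGroup_iff' _ _).1 O.2

theorem gridPoint_injective {N : ℕ} : Function.Injective fun z : Fin N => gridPoint N z := by
  intro z z' h
  have hN : (N : ℝ) ≠ 0 := by have := z.pos; positivity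
  simp only [gridPoint] at h
  rw [div_left_inj' hN, add_right_inj] at h
  exact Fin.ext (by exact_mod_cast h)

theorem rotatedPoint_injective : Function.Injective (rotatedPoint O n) := by
  intro k l h
  have h1 := congrArg (fun v => (O : Matrix (Fin d) (Fin d) ℝ) *ᵥ v) h
  simp only [rotatedPoint, Matrix.mulVec_mulVec, orthogonal_mul_transpose,
    Matrix.one_mulVec] at h1
  funext j
  exact gridPoint_injective (congrFun h1 j)

/-- Moving the rotation onto `y` reduces everything to the product grid. -/
theorem rotatedPoint_dotProduct (k : Fin d → Fin (2 ^ n)) (y : Fin d → ℝ) :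
    rotatedPoint O n k ⬝ᵥ y =
      ∑ j, gridPoint (2 ^ n) (k j) * ((O : Matrix (Fin d) (Fin d) ℝ) *ᵥ y) j := by
  rw [rotatedPoint, Matrix.mulVec_transpose, ← Matrix.dotProduct_mulVec]
  rfl

theorem card_rotatedGrid :
    (rotatedGrid (O : Matrix (Fin d) (Fin d) ℝ) n).card = (2 ^ n) ^ d := by
  rw [rotatedGrid_eq_image, Finset.card_image_of_injective _ (rotatedPoint_injective O n),
    Finset.card_univ, Fintype.card_fun, Fintype.card_fin, Fintype.card_fin]

theorem card_filter_rotatedGrid (t : ℝ) (y : Fin d → ℝ) :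
    ((rotatedGrid (O : Matrix (Fin d) (Fin d) ℝ) n).filter fun x => t ≤ |x ⬝ᵥ y|).card =
      (Finset.univ.filter fun k : Fin d → Fin (2 ^ n) =>
        t ≤ |∑ j, gridPoint (2 ^ n) (k j) * ((O : Matrix (Fin d) (Fin d) ℝ) *ᵥ y) j|).card := by
  rw [rotatedGrid_eq_image, Finset.filter_image,
    Finset.card_image_of_injective _ (rotatedPoint_injective O n)]
  simp_rw [rotatedPoint_dotProduct]

theorem sum_sq_orthogonal_mulVec (y : Fin d → ℝ) :
    ∑ j, ((O : Matrix (Fin d) (Fin d) ℝ) *ᵥ y) j ^ 2 = ∑ j, y j ^ 2 := by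
  have h : ∀ v : Fin d → ℝ, ∑ j, v j ^ 2 = v ⬝ᵥ v := fun v =>
    Finset.sum_congr rfl fun j _ => sq (v j)
  rw [h, h, Matrix.dotProduct_mulVec, Matrix.vecMul_mulVec, orthogonal_transpose_mul,
    Matrix.vecMul_one]

/-- Rotations preserve the `ℓ_2`-norm, so Hoeffding applies to `O y` and bounds the fraction by `2
(δ/2)² ≤ δ`. -/
theorem sqrt_log_mem_radiusSet (hd : 1 ≤ d) {q : ℝ≥0∞} (hq : 1 ≤ q) {δ : ℝ} (hδ : 0 < δ)
    (hδ' : δ ≤ 1 / 2) :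
    (d : ℝ) ^ max 0 (1 / 2 - recip q) * Real.sqrt (Real.log (2 / δ)) ∈
      {t : ℝ | 0 ≤ t ∧ ∀ y : Fin d → ℝ, lpNorm q y ≤ 1 →
        (((rotatedGrid (O : Matrix (Fin d) (Fin d) ℝ) n).filter fun x => t ≤ |x ⬝ᵥ y|).card : ℝ) /
          ((rotatedGrid (O : Matrix (Fin d) (Fin d) ℝ) n).card : ℝ) ≤ δ} := by
  have hd' : (0 : ℝ) < d := by exact_mod_cast hd
  have hD : (0 : ℝ) < (d : ℝ) ^ max 0 (1 / 2 - recip q) := by positivity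
  refine ⟨by positivity, fun y hy => ?_⟩
  have hlog : 0 ≤ Real.log (2 / δ) := Real.log_nonneg (by rw [le_div_iff₀ hδ]; linarith)
  have h1 : ∑ j, ((O : Matrix (Fin d) (Fin d) ℝ) *ᵥ y) j ^ 2 ≤
      ((d : ℝ) ^ max 0 (1 / 2 - recip q)) ^ 2 := by
    rw [sum_sq_orthogonal_mulVec]
    refine (sum_sq_le_lpNorm hd hq y).trans ?_
    have := lpNorm_nonneg hq y
    apply pow_le_pow_left₀ (by positivity)
    exact mul_le_of_le_one_right hD.le hy
  rw [card_filter_rotatedGrid, card_rotatedGrid, div_le_iff₀ (by positivity)]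
  refine (card_grid_abs_ge_le _ _ _ hD (by positivity) h1).trans ?_
  have h2 : -(2 * ((d : ℝ) ^ max 0 (1 / 2 - recip q) * Real.sqrt (Real.log (2 / δ))) ^ 2 /
      ((d : ℝ) ^ max 0 (1 / 2 - recip q)) ^ 2) = Real.log ((δ / 2) ^ 2) := by
    rw [mul_pow, Real.sq_sqrt hlog, Real.log_pow, ← inv_div 2 δ, Real.log_inv]
    field_simp
    push_cast
    ring
  rw [h2, Real.exp_log (by positivity), mul_comm δ]
  push_cast
  gcongr
  nlinarith

theorem effectiveRadius_le (hd : 1 ≤ d) {q : ℝ≥0∞} (hq : 1 ≤ q) {δ : ℝ} (hδ : 0 < δ)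
    (hδ' : δ ≤ 1 / 2) :
    effectiveRadius (rotatedGrid (O : Matrix (Fin d) (Fin d) ℝ) n) δ q ≤
      (d : ℝ) ^ max 0 (1 / 2 - recip q) * Real.sqrt (Real.log (2 / δ)) :=
  csInf_le ⟨0, fun _ ht => ht.1⟩ (sqrt_log_mem_radiusSet O n hd hq hδ hδ')

/-- A unit basis vector is the witness: for `t < 1/60` more than half of the points, hence more than
a `δ`-fraction, reach `t`. -/
theorem le_effectiveRadius (hd : 1 ≤ d) (hn : 5 ≤ n) {q : ℝ≥0∞} (hq : 1 ≤ q) {δ : ℝ} (hδ : 0 < δ)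
    (hδ' : δ ≤ 1 / 2) :
    1 / 60 ≤ effectiveRadius (rotatedGrid (O : Matrix (Fin d) (Fin d) ℝ) n) δ q := by
  refine le_csInf ⟨_, sqrt_log_mem_radiusSet O n hd hq hδ hδ'⟩ ?_
  rintro t ⟨_, ht⟩
  by_contra hlt
  rw [not_le] at hlt
  have h1 := ht (Pi.single ⟨0, hd⟩ 1) (lpNorm_single hq _)
  rw [card_filter_rotatedGrid, card_rotatedGrid, div_le_iff₀ (by positivity)] at h1
  set a := (O : Matrix (Fin d) (Fin d) ℝ) *ᵥ Pi.single ⟨0, hd⟩ 1 with ha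
  have hN : 32 ≤ 2 ^ n := le_trans (by norm_num) (Nat.pow_le_pow_right (by norm_num) hn)
  have h2 : ∑ j, a j ^ 2 = 1 := by
    rw [ha, sum_sq_orthogonal_mulVec, Finset.sum_eq_single ⟨0, hd⟩] <;> simp +contextual
  have h3 := card_grid_small hN a h2
  have h4 := Finset.card_filter_add_card_filter_not
    (s := (Finset.univ : Finset (Fin d → Fin (2 ^ n))))
    (fun k => t ≤ |∑ j, gridPoint (2 ^ n) (k j) * a j|)
  have h5 : (Finset.univ.filter fun k : Fin d → Fin (2 ^ n) =>
      ¬ t ≤ |∑ j, gridPoint (2 ^ n) (k j) * a j|).card ≤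
      (Finset.univ.filter fun k : Fin d → Fin (2 ^ n) =>
        |∑ j, gridPoint (2 ^ n) (k j) * a j| < 1 / 60).card := by
    refine Finset.card_le_card fun k => ?_
    simp only [Finset.mem_filter, Finset.mem_univ, true_and, not_le]
    exact fun h => h.trans hlt
  rw [Finset.card_univ, Fintype.card_fun, Fintype.card_fin, Fintype.card_fin] at h4
  have h6 : ((Finset.univ.filter fun k : Fin d → Fin (2 ^ n) =>
      t ≤ |∑ j, gridPoint (2 ^ n) (k j) * a j|).card : ℝ) +
      ((Finset.univ.filter fun k : Fin d → Fin (2 ^ n) =>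
      ¬ t ≤ |∑ j, gridPoint (2 ^ n) (k j) * a j|).card : ℝ) = ((2 ^ n : ℕ) : ℝ) ^ d := by
    exact_mod_cast h4
  have h7 : ((Finset.univ.filter fun k : Fin d → Fin (2 ^ n) =>
      ¬ t ≤ |∑ j, gridPoint (2 ^ n) (k j) * a j|).card : ℝ) ≤ _ := Nat.cast_le.2 h5
  have h8 : (0 : ℝ) < ((2 ^ n : ℕ) : ℝ) ^ d := by positivity
  rw [Nat.cast_pow (2 ^ n) d] at h1
  nlinarith

end Radius

/-! ### Phase estimation with the value oracle -/

section Estimator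

/-- The coordinatewise median of `K` independent outcomes is within the error `4 / κ` that a single
outcome exceeds, in any given coordinate, with probability at most `1 / 6`. -/
theorem one_sub_le_sum_median {Q : Type*} [Fintype Q] {d K : ℕ} (μ : Q → ℝ) (h0 : ∀ b, 0 ≤ μ b)
    (h1 : ∑ b, μ b = 1) (X : Fin d → ℝ) (val : Fin d → Q → ℝ) (κ : ℝ) (hκ : 0 < κ)
    (hbad : ∀ j, ∑ b with 4 < |X j - val j b|, μ b ≤ 1 / 6) (E : Set (Fin d → ℝ))
    (hE : ∀ u : Fin d → ℝ, (∀ j, |u j - X j / κ| ≤ 4 / κ) → u ∈ E) :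
    1 - d * (3 / 4) ^ K ≤ ∑ w : Fin K → Q,
      ((fun w j => median fun t => val j (w t) / κ) ⁻¹' E).indicator (fun w => ∏ t, μ (w t)) w := by
  refine one_sub_le_sum_indicator (fun w : Fin K → Q => ∏ t, μ (w t))
    (fun w => Finset.prod_nonneg fun t _ => h0 _) ?_
    (fun j w => K ≤ 2 * (Finset.univ.filter fun t => 4 < |X j - val j (w t)|).card) _
    (fun j => sum_prod_filter_majority_le μ h0 h1 (fun b => 4 < |X j - val j b|) (hbad j)) _ ?_
  · rw [← Fintype.sum_pow, h1, one_pow]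
  · intro w hw
    refine hE _ fun j => ?_
    have hwj := hw j
    rw [not_le] at hwj
    have h := median_mem_Icc (fun t => val j (w t) / κ) ((X j - 4) / κ) ((X j + 4) / κ) ?_
    · rw [sub_div, add_div] at h
      rw [abs_le]
      constructor <;> linarith [h.1, h.2]
    · refine lt_of_le_of_lt (Nat.mul_le_mul_left 2 (Finset.card_le_card fun t => ?_)) hwj
      simp only [Finset.mem_filter, Finset.mem_univ, true_and]
      intro ht
      by_contra hle
      refine ht ?_
      obtain ⟨h1, h2⟩ := abs_le.1 (not_lt.1 hle)
      constructor
      · exact div_le_div_of_nonneg_right (by linarith) hκ.le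
      · exact div_le_div_of_nonneg_right (by linarith) hκ.le

theorem submatrix_mem_unitaryGroup {I J : Type*} [Fintype I] [DecidableEq I] [Fintype J]
    [DecidableEq J] (e : J ≃ I) {A : Matrix I I ℂ} (hA : A ∈ Matrix.unitaryGroup I ℂ) :
    A.submatrix e e ∈ Matrix.unitaryGroup J ℂ := by
  rw [Matrix.mem_unitaryGroup_iff'] at hA ⊢
  rw [Matrix.star_eq_conjTranspose] at hA ⊢
  rw [Matrix.conjTranspose_submatrix, Matrix.submatrix_mul_equiv, hA, Matrix.submatrix_one_equiv]

theorem phaseState_eq {d : ℕ} {S : Type*} [DecidableEq S] (G : Finset (Fin d → ℝ)) (s₀ : S)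
    (φ : G → ℝ) : phaseState G s₀ φ = fun b : G × S =>
      (fun x : G => ((1 / Real.sqrt (G.card : ℝ) : ℝ) : ℂ) *
        Complex.exp (Complex.I * (φ x : ℂ))) b.1 * (Pi.single s₀ 1 : S → ℂ) b.2 := by
  funext b
  simp only [phaseState, Pi.single_apply]
  split_ifs <;> simp

theorem pow_mulVec_phaseState {d : ℕ} {S : Type*} [Fintype S] [DecidableEq S]
    {G : Finset (Fin d → ℝ)} {s₀ : S} {U : Matrix (G × S) (G × S) ℂ} {θ : G → ℝ}
    (hU : ∀ φ : G → ℝ, U *ᵥ phaseState G s₀ φ = phaseState G s₀ fun x => φ x + θ x)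
    (φ : G → ℝ) (i : ℕ) :
    U ^ i *ᵥ phaseState G s₀ φ = phaseState G s₀ fun x => φ x + i * θ x := by
  induction i with
  | zero => simp
  | succ i ih =>
    rw [pow_succ', ← Matrix.mulVec_mulVec, ih, hU]
    congr 1
    funext x
    push_cast; ring

variable {d : ℕ} (O : Matrix.orthogonalGroup (Fin d) ℝ) (n : ℕ)

/-- The indexing of the rotated grid. -/
noncomputable def gridEquiv :
    (Fin d → Fin (2 ^ n)) ≃ rotatedGrid (O : Matrix (Fin d) (Fin d) ℝ) n :=
  Equiv.ofBijective
    (fun k => ⟨rotatedPoint O n k, by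
      rw [rotatedGrid_eq_image]; exact Finset.mem_image_of_mem _ (Finset.mem_univ _)⟩)
    ⟨fun k l h => rotatedPoint_injective O n (congrArg Subtype.val h), fun ⟨x, hx⟩ => by
      have hx' := hx
      rw [rotatedGrid_eq_image] at hx'
      obtain ⟨k, -, hk⟩ := Finset.mem_image.1 hx'
      exact ⟨k, Subtype.ext hk⟩⟩

theorem coe_gridEquiv (k : Fin d → Fin (2 ^ n)) :
    ((gridEquiv O n k : rotatedGrid (O : Matrix (Fin d) (Fin d) ℝ) n) : Fin d → ℝ) =
      rotatedPoint O n k := rfl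

/-- The `d`-dimensional Fourier transform on the vector register. -/
noncomputable def gridFourier :
    Matrix.unitaryGroup (rotatedGrid (O : Matrix (Fin d) (Fin d) ℝ) n) ℂ :=
  ⟨(tensorPow d (fourierMatrix (2 ^ n) (2 ^ (n - 1)))).submatrix (gridEquiv O n).symm
    (gridEquiv O n).symm, submatrix_mem_unitaryGroup _
      (tensorPow_mem_unitaryGroup (fourierMatrix_mem_unitaryGroup (by positivity) _))⟩

/-- The vector whose Fourier transform is the uniform superposition. -/
noncomputable def gridOrigin (hn : 1 ≤ n) : rotatedGrid (O : Matrix (Fin d) (Fin d) ℝ) n :=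
  -- Index `k` carries frequency `k - 2^(n-1)`, so this is frequency zero in every coordinate.
  gridEquiv O n fun _ => ⟨2 ^ (n - 1), Nat.pow_lt_pow_right (by norm_num) (by omega)⟩

variable {S : Type*} [Fintype S] [DecidableEq S] (s₀ : S)

theorem normalization_eq :
    ((1 / Real.sqrt ((rotatedGrid (O : Matrix (Fin d) (Fin d) ℝ) n).card : ℝ) : ℝ) : ℂ) =
      ∏ _j : Fin d, ((1 / Real.sqrt ((2 ^ n : ℕ) : ℝ) : ℝ) : ℂ) := by
  rw [Finset.prod_const, Finset.card_univ, Fintype.card_fin, ← Complex.ofReal_pow, div_pow,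
    one_pow, card_rotatedGrid, Nat.cast_pow (2 ^ n) d]
  congr 2
  rw [Real.sqrt_eq_iff_eq_sq (by positivity) (by positivity), ← pow_mul, mul_comm, pow_mul,
    Real.sq_sqrt (by positivity)]

theorem gridFourier_mulVec_single (hn : 1 ≤ n) :
    (liftGate S (gridFourier O n) : Matrix _ _ ℂ) *ᵥ Pi.single (gridOrigin O n hn, s₀) 1 =
      phaseState (rotatedGrid (O : Matrix (Fin d) (Fin d) ℝ) n) s₀ fun _ => 0 := by
  have h0 : (Pi.single (gridOrigin O n hn, s₀) 1 :
      rotatedGrid (O : Matrix (Fin d) (Fin d) ℝ) n × S → ℂ) = fun b =>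
      (Pi.single (gridOrigin O n hn) 1 : _ → ℂ) b.1 * (Pi.single s₀ 1 : S → ℂ) b.2 := by
    funext b
    obtain ⟨x, s⟩ := b
    simp only [Pi.single_apply, Prod.mk.injEq]
    by_cases h1 : x = gridOrigin O n hn <;> simp [h1]
  rw [h0, phaseState_eq]
  refine (kronecker_one_mulVec _ _ _).trans ?_
  funext b
  congr 1
  rw [Matrix.mulVec_single_one]
  simp only [gridFourier, gridOrigin, Matrix.col_apply, Matrix.submatrix_apply,
    Equiv.symm_apply_apply, tensorPow, fourierMatrix]
  rw [normalization_eq]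
  simp

/-- A phase linear in the grid coordinates is a product state, on which the inverse transform acts
coordinate by coordinate. -/
theorem star_gridFourier_mulVec_phaseState (φ : rotatedGrid (O : Matrix (Fin d) (Fin d) ℝ) n → ℝ)
    (X : Fin d → ℝ)
    (hφ : ∀ k, φ (gridEquiv O n k) = ∑ j, 2 * Real.pi * gridPoint (2 ^ n) (k j) * X j)
    (b : rotatedGrid (O : Matrix (Fin d) (Fin d) ℝ) n × S) :
    ((liftGate S (star (gridFourier O n)) : Matrix _ _ ℂ) *ᵥ
      phaseState (rotatedGrid (O : Matrix (Fin d) (Fin d) ℝ) n) s₀ φ) b =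
      (∏ j, fourierSum (2 ^ n) (X j - (((gridEquiv O n).symm b.1 j : ℝ) - (2 ^ (n - 1) : ℕ)))) *
        (Pi.single s₀ 1 : S → ℂ) b.2 := by
  rw [phaseState_eq]
  refine (congrFun (kronecker_one_mulVec (W := S)
    ((star (gridFourier O n) : Matrix.unitaryGroup _ ℂ) :
      Matrix (rotatedGrid (O : Matrix (Fin d) (Fin d) ℝ) n) _ ℂ)
    (fun x : rotatedGrid (O : Matrix (Fin d) (Fin d) ℝ) n =>
      ((1 / Real.sqrt ((rotatedGrid (O : Matrix (Fin d) (Fin d) ℝ) n).card : ℝ) : ℝ) : ℂ) *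
        Complex.exp (Complex.I * (φ x : ℂ))) (Pi.single s₀ 1)) b).trans ?_
  refine congrArg (fun z : ℂ => z * (Pi.single s₀ 1 : S → ℂ) b.2) ?_
  have h1 : (fun x : rotatedGrid (O : Matrix (Fin d) (Fin d) ℝ) n =>
      ((1 / Real.sqrt ((rotatedGrid (O : Matrix (Fin d) (Fin d) ℝ) n).card : ℝ) : ℝ) : ℂ) *
        Complex.exp (Complex.I * (φ x : ℂ))) =
      (fun z : Fin d → Fin (2 ^ n) => ∏ j, ((1 / Real.sqrt ((2 ^ n : ℕ) : ℝ) : ℝ) : ℂ) *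
        Complex.exp (Complex.I * (2 * Real.pi * gridPoint (2 ^ n) (z j) * X j : ℝ))) ∘
        (gridEquiv O n).symm := by
    funext x
    obtain ⟨k, rfl⟩ := (gridEquiv O n).surjective x
    rw [Function.comp_apply, Equiv.symm_apply_apply, Finset.prod_mul_distrib, normalization_eq,
      ← Complex.exp_sum, ← Finset.mul_sum, ← Complex.ofReal_sum, hφ]
  rw [h1]
  have h2 : ((star (gridFourier O n) : Matrix.unitaryGroup _ ℂ) : Matrix _ _ ℂ) =
      (tensorPow d (star (fourierMatrix (2 ^ n) (2 ^ (n - 1))))).submatrix (gridEquiv O n).symm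
        (gridEquiv O n).symm := by
    rw [← star_tensorPow]; rfl
  rw [h2, Matrix.submatrix_mulVec_equiv, Function.comp_assoc, Equiv.symm_symm,
    Equiv.symm_comp_self, Function.comp_id, Function.comp_apply]
  refine (tensorPow_mulVec (star (fourierMatrix (2 ^ n) (2 ^ (n - 1)))) (fun j z =>
    ((1 / Real.sqrt ((2 ^ n : ℕ) : ℝ) : ℝ) : ℂ) *
      Complex.exp (Complex.I * (2 * Real.pi * gridPoint (2 ^ n) z * X j : ℝ))) _).trans ?_
  refine Finset.prod_congr rfl fun j _ => ?_
  exact star_fourierMatrix_mulVec (by positivity) _ _ _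

theorem sum_outcome_filter (X : Fin d → ℝ) (P : (Fin d → Fin (2 ^ n)) → Prop) [DecidablePred P] :
    ∑ b : rotatedGrid (O : Matrix (Fin d) (Fin d) ℝ) n × S with P ((gridEquiv O n).symm b.1),
      ‖(∏ j, fourierSum (2 ^ n) (X j - (((gridEquiv O n).symm b.1 j : ℝ) - (2 ^ (n - 1) : ℕ)))) *
        (Pi.single s₀ 1 : S → ℂ) b.2‖ ^ 2 =
      ∑ k : Fin d → Fin (2 ^ n) with P k,
        ∏ j, ‖fourierSum (2 ^ n) (X j - ((k j : ℝ) - (2 ^ (n - 1) : ℕ)))‖ ^ 2 := by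
  rw [Finset.sum_filter, Finset.sum_filter, Fintype.sum_prod_type,
    ← Equiv.sum_comp (gridEquiv O n)]
  refine Finset.sum_congr rfl fun k _ => ?_
  rw [Finset.sum_eq_single s₀]
  · simp [Finset.prod_pow, norm_prod]
  · intro s _ hs
    simp [hs]
  · simp

/-- The coordinatewise median of the rescaled measurement outcomes. -/
noncomputable def medianEstimate (κ : ℝ) {K : ℕ}
    (w : Fin K → rotatedGrid (O : Matrix (Fin d) (Fin d) ℝ) n × S) : Fin d → ℝ :=
  fun j => median fun t =>
    (((gridEquiv O n).symm (w t).1 j : ℝ) - (2 ^ (n - 1) : ℕ)) / κ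

/-- Repeated phase estimation with a median: if the oracle imprints the phase `c xᵀ v` on `|x⟩` and
`M c = 2 π κ`, every coordinate of `O v` is found up to `4 / κ`. -/
theorem exists_phase_estimator (hn : 1 ≤ n) (M K : ℕ) (hM : 0 < M) (c κ : ℝ) (hκ : 0 < κ)
    (hMc : M * c = 2 * Real.pi * κ) :
    ∃ A : QueryAlgorithm (rotatedGrid (O : Matrix (Fin d) (Fin d) ℝ) n × S) (Fin d → ℝ),
      A.queries = K * M ∧ ∀ (v : Fin d → ℝ)
        (U : Matrix.unitaryGroup (rotatedGrid (O : Matrix (Fin d) (Fin d) ℝ) n × S) ℂ),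
        (∀ φ, (U : Matrix _ _ ℂ) *ᵥ
            phaseState (rotatedGrid (O : Matrix (Fin d) (Fin d) ℝ) n) s₀ φ =
          phaseState (rotatedGrid (O : Matrix (Fin d) (Fin d) ℝ) n) s₀ fun x => φ x + c * ((x : Fin d → ℝ) ⬝ᵥ v)) →
        (∀ j, |κ * ((O : Matrix (Fin d) (Fin d) ℝ) *ᵥ v) j| ≤ 2 ^ n / 2 - 4) →
        ∀ E : Set (Fin d → ℝ),
          (∀ u, (∀ j, |u j - ((O : Matrix (Fin d) (Fin d) ℝ) *ᵥ v) j| ≤ 4 / κ) → u ∈ E) →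
          1 - d * (3 / 4) ^ K ≤ A.prob U E := by
  refine ⟨repeatedAlgorithm (liftGate S (gridFourier O n)) (liftGate S (star (gridFourier O n)))
    (gridOrigin O n hn, s₀) M K (medianEstimate O n κ), rfl, ?_⟩
  intro v U hU hv E hE
  set X : Fin d → ℝ := fun j => κ * ((O : Matrix (Fin d) (Fin d) ℝ) *ᵥ v) j with hX
  rw [repeatedAlgorithm_prob _ _ _ _ _ _ _ hM]
  have hrun : ∀ b, runState (liftGate S (gridFourier O n)) (liftGate S (star (gridFourier O n)))
      (gridOrigin O n hn, s₀) M U b =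
      (∏ j, fourierSum (2 ^ n) (X j - (((gridEquiv O n).symm b.1 j : ℝ) - (2 ^ (n - 1) : ℕ)))) *
        (Pi.single s₀ 1 : S → ℂ) b.2 := by
    intro b
    rw [runState, gridFourier_mulVec_single, pow_mulVec_phaseState hU]
    refine star_gridFourier_mulVec_phaseState O n s₀ _ X (fun k => ?_) b
    rw [coe_gridEquiv, rotatedPoint_dotProduct, zero_add, ← mul_assoc, hMc, Finset.mul_sum]
    exact Finset.sum_congr rfl fun j _ => by simp only [hX]; ring
  set μ : rotatedGrid (O : Matrix (Fin d) (Fin d) ℝ) n × S → ℝ := fun b =>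
    ‖(∏ j, fourierSum (2 ^ n) (X j - (((gridEquiv O n).symm b.1 j : ℝ) - (2 ^ (n - 1) : ℕ)))) *
        (Pi.single s₀ 1 : S → ℂ) b.2‖ ^ 2 with hμ
  have hfun : (fun w : Fin K → rotatedGrid (O : Matrix (Fin d) (Fin d) ℝ) n × S =>
      ∏ t, ‖runState (liftGate S (gridFourier O n)) (liftGate S (star (gridFourier O n)))
      (gridOrigin O n hn, s₀) M U (w t)‖ ^ 2) = fun w => ∏ t, μ (w t) := by
    funext w
    refine Finset.prod_congr rfl fun t _ => ?_
    rw [hrun]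
  rw [hfun]
  have hμ0 : ∀ b, 0 ≤ μ b := fun b => by positivity
  have hNpos : 0 < 2 ^ n := by positivity
  have hone : ∀ j, ∑ k : Fin (2 ^ n),
      ‖fourierSum (2 ^ n) (X j - ((k : ℝ) - (2 ^ (n - 1) : ℕ)))‖ ^ 2 = 1 := fun j =>
    sum_norm_fourierSum_sq hNpos _ _
  have hμ1 : ∑ b, μ b = 1 := by
    have h := sum_outcome_filter O n s₀ X fun _ => True
    simp only [Finset.filter_true] at h
    rw [hμ, h]
    have h2 := (Finset.prod_univ_sum (fun _ : Fin d => (Finset.univ : Finset (Fin (2 ^ n))))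
      fun j k => ‖fourierSum (2 ^ n) (X j - ((k : ℝ) - (2 ^ (n - 1) : ℕ)))‖ ^ 2).symm
    rw [Fintype.piFinset_univ] at h2
    rw [h2]
    exact Finset.prod_eq_one fun j _ => hone j
  have hbad : ∀ j, ∑ b with 4 < |X j - (((gridEquiv O n).symm b.1 j : ℝ) - (2 ^ (n - 1) : ℕ))|,
      μ b ≤ 1 / 6 := by
    intro j
    -- The outcome distribution is a product, so only the marginal of coordinate `j` matters.
    rw [hμ, sum_outcome_filter O n s₀ X fun k => 4 < |X j - ((k j : ℝ) - (2 ^ (n - 1) : ℕ))|]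
    have h := sum_prod_filter_coord (fun (j : Fin d) (k : Fin (2 ^ n)) =>
      ‖fourierSum (2 ^ n) (X j - ((k : ℝ) - (2 ^ (n - 1) : ℕ)))‖ ^ 2) hone j
      fun k => 4 < |X j - ((k : ℝ) - (2 ^ (n - 1) : ℕ))|
    refine h.le.trans ?_
    refine sum_norm_fourierSum_sq_tail_le hNpos (2 ^ (n - 1)) ?_ (X j) ?_
    · rw [← pow_succ']; congr 1; omega
    · push_cast; exact hv j
  refine one_sub_le_sum_median (K := K) μ hμ0 hμ1 X
    (fun j b => ((gridEquiv O n).symm b.1 j : ℝ) - (2 ^ (n - 1) : ℕ)) κ hκ hbad E fun u hu => ?_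
  refine hE u fun j => ?_
  have hXκ : X j / κ = ((O : Matrix (Fin d) (Fin d) ℝ) *ᵥ v) j := by
    simp only [hX]; field_simp
  rw [← hXκ]
  exact hu j

end Estimator

/-! ### Choice of parameters and the main theorem -/

section Main

theorem abs_orthogonal_mulVec_le {d : ℕ} (hd : 1 ≤ d) (O : Matrix.orthogonalGroup (Fin d) ℝ)
    {q : ℝ≥0∞} (hq : 1 ≤ q) {B : ℝ} (v : Fin d → ℝ) (hv : lpNorm q v ≤ B) (j : Fin d) :
    |((O : Matrix (Fin d) (Fin d) ℝ) *ᵥ v) j| ≤ (d : ℝ) ^ (1 / 2 : ℝ) * B := by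
  have hd' : (1 : ℝ) ≤ d := by exact_mod_cast hd
  have hv0 := lpNorm_nonneg hq v
  have h1 : ((O : Matrix (Fin d) (Fin d) ℝ) *ᵥ v) j ^ 2 ≤
      ((d : ℝ) ^ max 0 (1 / 2 - recip q) * lpNorm q v) ^ 2 := by
    refine le_trans ?_ ((sum_sq_orthogonal_mulVec O v).le.trans (sum_sq_le_lpNorm hd hq v))
    exact Finset.single_le_sum (f := fun j => ((O : Matrix (Fin d) (Fin d) ℝ) *ᵥ v) j ^ 2)
      (fun _ _ => sq_nonneg _) (Finset.mem_univ j)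
  refine (abs_le_of_sq_le_sq h1 (by positivity)).trans ?_
  have h2 : max 0 (1 / 2 - recip q) ≤ 1 / 2 :=
    max_le (by norm_num) (by linarith [recip_nonneg q])
  gcongr

theorem mul_three_quarters_pow_le {d K : ℕ} (hd : 1 ≤ d)
    (hK : 4 * Real.log (6 * d) ≤ K) : (d : ℝ) * (3 / 4) ^ K ≤ 1 / 6 := by
  have hd' : (1 : ℝ) ≤ d := by exact_mod_cast hd
  have h1 : (3 / 4 : ℝ) ≤ Real.exp (-(1 / 4)) := by
    linarith [Real.add_one_le_exp (-(1 / 4) : ℝ)]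
  have h2 : (3 / 4 : ℝ) ^ K ≤ (6 * d : ℝ)⁻¹ := by
    calc (3 / 4 : ℝ) ^ K ≤ Real.exp (-(1 / 4)) ^ K := by gcongr
      _ = Real.exp (K * -(1 / 4)) := (Real.exp_nat_mul _ _).symm
      _ ≤ Real.exp (-Real.log (6 * d)) := Real.exp_le_exp.2 (by linarith)
      _ = (6 * d : ℝ)⁻¹ := by rw [Real.exp_neg, Real.exp_log (by positivity)]
  calc (d : ℝ) * (3 / 4) ^ K ≤ d * (6 * d : ℝ)⁻¹ := by gcongr
    _ = 1 / 6 := by field_simp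

end Main

end QMC

theorem mainTheorem8 :
    ∃ (C : ℝ) (m : ℕ), 0 < C ∧
      ∀ (d n : ℕ) (S : Type*) [Fintype S] [DecidableEq S] (s₀ : S) (p q : ℝ≥0∞)
        (ε Rmax B δ : ℝ) (O : Matrix.orthogonalGroup (Fin d) ℝ),
        1 ≤ d → 1 ≤ p → 1 ≤ q → 0 < ε → ε < Rmax → Rmax ≤ B → 0 < δ → δ ≤ 1 / 2 →
        24 * (d : ℝ) ^ (1 / 2 + QMC.recip p) * B / ε ≤ 2 ^ n →
        let G : Finset (Fin d → ℝ) := QMC.rotatedGrid (O : Matrix (Fin d) (Fin d) ℝ) n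
        let r : ℝ := QMC.effectiveRadius G δ q
        let M : ℕ := ⌈32 * Real.pi * r * Rmax * (d : ℝ) ^ QMC.recip p / ε⌉₊
        let L : ℝ := Real.log (2 + d * Rmax / ε)
        ∃ A : QMC.QueryAlgorithm (G × S) (Fin d → ℝ),
          (A.queries : ℝ) ≤ C * M * L ^ m ∧
          (A.queries : ℝ) ≤ C * (r * Rmax * (d : ℝ) ^ QMC.recip p / ε) * L ^ m ∧
          (A.queries : ℝ) ≤ C * (Rmax / ε *
              (d : ℝ) ^ (QMC.recip p + max 0 (1 / 2 - QMC.recip q))) *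
              Real.sqrt (Real.log (2 / δ)) * L ^ m ∧
          ∀ V : S → Fin d → ℝ, QMC.lpNorm q (V s₀) ≤ B →
            ∀ U : Matrix.unitaryGroup (G × S) ℂ, QMC.IsValueOracle G δ q Rmax V s₀ U →
              5 / 6 ≤ A.prob U
                {v | QMC.lpNorm p (v - (O : Matrix (Fin d) (Fin d) ℝ) *ᵥ V s₀) ≤ ε} := by
  -- `1116 = 9 · 124`, from `K ≤ 9 L` and `M' ≤ 124 y`.
  refine ⟨1116, 1, by norm_num, ?_⟩
  intro d n S _ _ s₀ p q ε Rmax B δ O hd hp hq hε hεR hRB hδ hδ' hgrid G r M L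
  have hd' : (1 : ℝ) ≤ d := by exact_mod_cast hd
  have hd0 : (0 : ℝ) < d := by linarith
  have hR : 0 < Rmax := hε.trans hεR
  have hB : 0 < B := by linarith
  have hpi := Real.pi_gt_three
  have hpi4 := Real.pi_le_four
  set T : ℝ := (d : ℝ) ^ QMC.recip p with hT
  set Z : ℝ := (d : ℝ) ^ (1 / 2 : ℝ) with hZ
  have hT1 : 1 ≤ T := Real.one_le_rpow hd' (QMC.recip_nonneg p)
  have hZ1 : 1 ≤ Z := Real.one_le_rpow hd' (by norm_num)
  have hZT : (d : ℝ) ^ (1 / 2 + QMC.recip p) = Z * T := Real.rpow_add hd0 _ _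
  rw [hZT] at hgrid
  have hBε : 1 < B / ε := by rw [one_lt_div hε]; linarith
  have hA : 24 * (Z * T * (B / ε)) ≤ 2 ^ n := by
    refine le_trans (le_of_eq ?_) hgrid
    ring
  have hZT1 : 1 ≤ Z * T := one_le_mul_of_one_le_of_one_le hZ1 hT1
  have hn : 5 ≤ n := by
    by_contra hlt
    have h1 : (2 : ℝ) ^ n ≤ 2 ^ 4 := pow_le_pow_right₀ (by norm_num) (by omega)
    have h2 : 1 < Z * T * (B / ε) := one_lt_mul_of_le_of_lt hZT1 hBε
    linarith
  have hN32 : (32 : ℝ) ≤ 2 ^ n :=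
    le_trans (by norm_num) (pow_le_pow_right₀ (by norm_num : (1 : ℝ) ≤ 2) hn)
  have hr : 1 / 60 ≤ r := QMC.le_effectiveRadius O n hd hn hq hδ hδ'
  have hr0 : 0 < r := by linarith
  have hr' : r ≤ (d : ℝ) ^ max 0 (1 / 2 - QMC.recip q) * Real.sqrt (Real.log (2 / δ)) :=
    QMC.effectiveRadius_le O n hd hq hδ hδ'
  set y : ℝ := r * Rmax * T / ε with hy
  have hRε : 1 ≤ Rmax / ε := by rw [one_le_div hε]; exact hεR.le
  have hy60 : 1 / 60 ≤ y := by
    have h1 : y = r * (Rmax / ε * T) := by rw [hy]; ring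
    have h2 : 1 ≤ Rmax / ε * T := one_le_mul_of_one_le_of_one_le hRε hT1
    rw [h1]
    linarith [mul_le_mul hr h2 zero_le_one hr0.le]
  have hy0 : 0 < y := by linarith
  have hpiy : 16 * Real.pi * y ≤ 64 * y := mul_le_mul_of_nonneg_right (by linarith) hy0.le
  -- Half the constant of `M` suffices: `4 T / κ ≤ ε` is equivalent to `M' ≥ 16 π y`.
  set M' : ℕ := ⌈16 * Real.pi * y⌉₊ with hM'
  have hM'1 : 16 * Real.pi * y ≤ M' := Nat.le_ceil _
  have hM'2 : (M' : ℝ) ≤ 16 * Real.pi * y + 1 := (Nat.ceil_lt_add_one (by positivity)).le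
  have hM'0 : 0 < M' := Nat.ceil_pos.2 (by positivity)
  have hM'M : (M' : ℝ) ≤ M := by
    refine Nat.cast_le.2 (Nat.ceil_mono ?_)
    have h1 : 32 * Real.pi * r * Rmax * T / ε = 32 * Real.pi * y := by rw [hy]; ring
    rw [h1]
    linarith [mul_pos Real.pi_pos hy0]
  -- The rounding term 1 is at most `60 y`, thanks to `r ≥ 1/60`.
  have hM'y : (M' : ℝ) ≤ 124 * y := by linarith
  set K : ℕ := ⌈4 * Real.log (6 * d)⌉₊ with hK
  have hL2 : Real.log (2 + d) ≤ L := by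
    refine Real.log_le_log (by positivity) ?_
    rw [mul_div_assoc]
    linarith [le_mul_of_one_le_right hd0.le hRε]
  have hL1 : 1 ≤ L := by
    refine le_trans ?_ hL2
    rw [Real.le_log_iff_exp_le (by positivity)]
    linarith [Real.exp_one_lt_d9]
  have hKL : (K : ℝ) ≤ 9 * L := by
    have h1 : Real.log (6 * d) ≤ 2 * Real.log (2 + d) := by
      have h2 : 2 * Real.log (2 + d) = Real.log ((2 + d) ^ 2) := by
        rw [Real.log_pow]; norm_num
      rw [h2]
      exact Real.log_le_log (by positivity) (by nlinarith [sq_nonneg ((d : ℝ) - 1)])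
    have h3 : 0 ≤ 4 * Real.log (6 * d) :=
      mul_nonneg (by norm_num) (Real.log_nonneg (by linarith))
    have h4 := (Nat.ceil_lt_add_one h3).le
    rw [← hK] at h4
    linarith
  set κ : ℝ := M' / (4 * Real.pi * r * Rmax) with hκ
  have hκ0 : 0 < κ := by positivity
  have hMc : (M' : ℝ) * (1 / (2 * r * Rmax)) = 2 * Real.pi * κ := by
    rw [hκ]; field_simp; ring
  have hκ1 : 4 / κ * T ≤ ε := by
    rw [div_mul_eq_mul_div, div_le_iff₀ hκ0, hκ, ← mul_div_assoc, le_div_iff₀ (by positivity)]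
    have h1 : 4 * T * (4 * Real.pi * r * Rmax) = ε * (16 * Real.pi * y) := by
      rw [hy]; field_simp; ring
    rw [h1]
    gcongr
  -- Rounding in `M'` adds at most `1 / (4 π r Rmax)`, and `4 π r ≥ 12/60`.
  have hκ2 : κ ≤ 4 * T / ε + 5 / Rmax := by
    rw [hκ, div_le_iff₀ (by positivity)]
    have h1 : (4 * T / ε + 5 / Rmax) * (4 * Real.pi * r * Rmax) =
        16 * Real.pi * y + 20 * (Real.pi * r) := by
      rw [hy]; field_simp; ring
    rw [h1]
    linarith [mul_le_mul hpi.le hr (by norm_num) Real.pi_pos.le]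
  obtain ⟨A, hAq, hAp⟩ := QMC.exists_phase_estimator O n s₀ (by omega) M' K hM'0
    (1 / (2 * r * Rmax)) κ hκ0 hMc
  have hq1 : (A.queries : ℝ) = K * M' := by rw [hAq]; push_cast; ring
  have hbound2 : (A.queries : ℝ) ≤ 1116 * y * L ^ 1 := by
    rw [hq1, pow_one]
    calc (K : ℝ) * M' ≤ 9 * L * (124 * y) := by gcongr
      _ = 1116 * y * L := by ring
  refine ⟨A, ?_, hbound2, ?_, ?_⟩
  · rw [hq1, pow_one]
    have h1 : (K : ℝ) * M' ≤ 9 * L * M := by gcongr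
    have h2 : 0 ≤ L * M := by positivity
    linarith
  · refine hbound2.trans ?_
    rw [mul_assoc 1116 (_ * _)]
    gcongr
    rw [Real.rpow_add hd0, ← hT]
    calc y = r * (Rmax / ε * T) := by rw [hy]; ring
      _ ≤ (d : ℝ) ^ max 0 (1 / 2 - QMC.recip q) * Real.sqrt (Real.log (2 / δ)) *
          (Rmax / ε * T) := by gcongr
      _ = _ := by ring
  · intro V hV U hU
    have hprob := hAp (V s₀) U ?_ ?_
      {v | QMC.lpNorm p (v - (O : Matrix (Fin d) (Fin d) ℝ) *ᵥ V s₀) ≤ ε} ?_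
    · refine le_trans ?_ hprob
      have := QMC.mul_three_quarters_pow_le (K := K) hd (Nat.le_ceil _)
      linarith
    · intro φ
      rw [hU φ]
      congr 1
      funext x
      rw [one_div_mul_eq_div]
    · intro j
      have hw := QMC.abs_orthogonal_mulVec_le hd O hq (V s₀) hV j
      rw [abs_mul, abs_of_pos hκ0]
      calc κ * |((O : Matrix (Fin d) (Fin d) ℝ) *ᵥ V s₀) j|
          ≤ (4 * T / ε + 5 / Rmax) * (Z * B) := by gcongr
        _ ≤ (4 * T / ε + 5 * T / ε) * (Z * B) := by
            gcongr
            linarith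
        _ = 9 * (Z * T * (B / ε)) := by ring
        -- The grid hypothesis bounds the left side by `(9/24) 2^n`, and `2^n / 8 ≥ 4` since `n ≥
        -- 5`.
        _ ≤ 2 ^ n / 2 - 4 := by linarith
    · intro u hu
      refine (QMC.lpNorm_le_of_forall_abs_le hp _ (4 / κ) (by positivity) hu).trans ?_
      rw [mul_comm]
      exact hκ1
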